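/- Let $M$ be a smooth $n$-dimensional manifold and $F$ a Finsler metric on $M$: $F\ge 0$ on $TM$, $F$ is $C^\infty$ on $TM\setminus 0$, $F(\lambda y)=\lambda F(y)$ for $\lambda>0$, and for each $y\neq0$ the form $\mathbf g_y(u,v)=\frac12\frac{\partial^2}{\partial s\partial t}F^2(y+su+tv)|_{s=t=0}$ is positive definite. In local coordinates let $G^i=\frac14 g^{il}\{\frac{\partial^2F^2}{\partial x^k\partial y^l}y^k-\frac{\partial F^2}{\partial x^l}\}$ be the spray coefficients, $B_j{}^i{}_{kl}=\frac{\partial^3G^i}{\partial y^j\partial y^k\partial y^l}$ the Berwald curvature, $E_{jk}=\frac12B_j{}^m{}_{km}$, and $$R^i{}_k=2\frac{\partial G^i}{\partial x^k}-\frac{\partial^2G^i}{\partial x^m\partial y^k}y^m+2G^m\frac{\partial^2G^i}{\partial y^m\partial y^k}-\frac{\partial G^i}{\partial y^m}\frac{\partial G^m}{\partial y^k},$$ $$D_j{}^i{}_{kl}=B_j{}^i{}_{kl}-\frac1{n+1}\frac{\partial^3}{\partial y^j\partial y^k\partial y^l}\Big(\frac{\partial G^m}{\partial y^m}y^i\Big)$$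 the Riemann curvature and the Douglas tensor. Let "$.$" denote $\partial/\partial y$, let "$|$" denote the horizontal covariant derivative of the Berwald connection, and let the index $0$ denote contraction with $y$. Put $\tilde D_j{}^i{}_{kl}=D_j{}^i{}_{kl|0}$ and, for $n\ge2$, $R=\frac1{n-1}R^m{}_m$ and $\theta_{jkl}=2E_{jk|l}-\frac13\big(R^s{}_{l.s}-(n+2)R_{.l}\big)_{.j.k}$. The flag curvature is $K(y,u)=\mathbf g_y(\mathbf R_y(u),u)/(\mathbf g_y(y,y)\mathbf g_y(u,u)-\mathbf g_y(y,u)^2)$ for linearly independent $y,u$. The $S$-curvature is the derivative along geodesics of the distortion $\tau=\ln\big(\sqrt{\det(g_{ij})}/\sigma_F\big)$, where $\sigma_F(x)=\mathrm{Vol}(\mathbb B^n)/\mathrm{Vol}\{y: F(x,y)<1\}$. The metric $F$ is a Douglas metric if $D=0$; it is a generalized $\tilde D$-metric if $\tilde D_j{}^i{}_{kl|0}+\mu_r\tilde D_j{}^r{}_{kl}\,y^i=0$ on $TM\setminus0$ for some smooth tensor $\mu=\mu_r\,dx^r$ on $TM\setminus0$. The class of Douglas metrics is a proper subclass of the class of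 generalized $\tilde D$-metrics: (1) Every Douglas metric, on any manifold, is a generalized $\tilde D$-metric. (2) On the unit ball $\Omega=\{(x,y,z)\in\mathbb R^3: x^2+y^2+z^2<1\}$, with tangent vectors written $(u,v,w)$, let $F=\alpha+\beta$, where $$\alpha=\frac{\sqrt{(-yu+xv)^2+(u^2+v^2+w^2)(1-x^2-y^2)}}{1-x^2-y^2},\qquad \beta=\frac{-yu+xv}{1-x^2-y^2}.$$ Then $F$ is a Finsler metric, and a Randers metric ($\alpha$ is the norm of a Riemannian metric and $\beta$ is a 1-form with $\|\beta\|_\alpha<1$ at every point). It has $K=0$ and $S=0$, and $\beta$ is not closed. Moreover $\theta=0$ and $\tilde D=0$, whereas the Douglas tensor $D$ of $F$ is not identically zero. Hence $F$ is a generalized $\tilde D$-metric which is not a Douglas metric. -/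

import Mathlib

open scoped Manifold ContDiff

namespace FinslerGeom

noncomputable section

/-- The coordinate space `ℝⁿ`. -/
abbrev Coord (n : ℕ) : Type := EuclideanSpace ℝ (Fin n)

/-- The `i`-th coordinate vector of `ℝⁿ`. -/
def coordVec {n : ℕ} (i : Fin n) : Coord n := EuclideanSpace.single i 1

/-! ### Calculus with functions `f (x, y)` of the position `x` and the direction `y` -/

/-- `∂f/∂xⁱ` -/
def dx {n : ℕ} (i : Fin n) (f : Coord n → Coord n → ℝ) : Coord n → Coord n → ℝ :=
  fun x y => lineDeriv ℝ (fun x' => f x' y) x (coordVec i)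

/-- `∂f/∂yⁱ` (the vertical derivative `f_{.i}`) -/
def dy {n : ℕ} (i : Fin n) (f : Coord n → Coord n → ℝ) : Coord n → Coord n → ℝ :=
  fun x y => lineDeriv ℝ (f x) y (coordVec i)

/-- The form `g_y(u, v) = (1/2) ∂²/∂s∂t [φ²(y + s u + t v)]` at `s = t = 0` of a function `φ`
on a real vector space. -/
def fundForm {V : Type*} [AddCommGroup V] [Module ℝ V] (φ : V → ℝ) (y u v : V) : ℝ :=
  (1 / 2) * lineDeriv ℝ (fun y' => lineDeriv ℝ (fun w => φ w ^ 2) y' v) y u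

/-! ### Local quantities of a Finsler metric, given by its coordinate expression `L (x, y)` -/

section LocalQuantities

variable {n : ℕ}

/-- The fundamental tensor `g_{ij}(x, y)`. -/
def gMat (L : Coord n → Coord n → ℝ) (x y : Coord n) : Matrix (Fin n) (Fin n) ℝ :=
  Matrix.of fun i j => fundForm (L x) y (coordVec i) (coordVec j)

/-- The spray coefficients
`Gⁱ = (1/4) gⁱˡ { (∂²F²/∂xᵏ∂yˡ) yᵏ - ∂F²/∂xˡ }`. -/
def spray (L : Coord n → Coord n → ℝ) (i : Fin n) : Coord n → Coord n → ℝ :=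
  fun x y => (1 / 4) * ∑ l, (gMat L x y)⁻¹ i l *
    ((∑ k, dx k (dy l (fun x y => L x y ^ 2)) x y * y k) - dx l (fun x y => L x y ^ 2) x y)

/-- The Berwald nonlinear connection `Nⁱ_j = ∂Gⁱ/∂yʲ`. -/
def nonlinConn (L : Coord n → Coord n → ℝ) (i j : Fin n) : Coord n → Coord n → ℝ :=
  dy j (spray L i)

/-- The coefficients `Γⁱ_{jk} = ∂²Gⁱ/∂yʲ∂yᵏ` of the Berwald connection. -/
def berwaldConn (L : Coord n → Coord n → ℝ) (i j k : Fin n) : Coord n → Coord n → ℝ :=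
  dy k (dy j (spray L i))

/-- The Riemann curvature `Rⁱ_k`. -/
def riemann (L : Coord n → Coord n → ℝ) (i k : Fin n) : Coord n → Coord n → ℝ :=
  fun x y => 2 * dx k (spray L i) x y
    - ∑ m, dx m (dy k (spray L i)) x y * y m
    + 2 * ∑ m, spray L m x y * dy m (dy k (spray L i)) x y
    - ∑ m, dy m (spray L i) x y * dy k (spray L m) x y

/-- The flag curvature
`K(y, u) = g_y(R_y(u), u) / (g_y(y, y) g_y(u, u) - g_y(y, u)²)`
of the flag spanned by the linearly independent vectors `y` (flagpole) and `u`. -/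
def flagCurvature (L : Coord n → Coord n → ℝ) (x y u : Coord n) : ℝ :=
  (∑ i, ∑ j, ∑ k, gMat L x y i j * riemann L i k x y * u k * u j) /
    (fundForm (L x) y y y * fundForm (L x) y u u - fundForm (L x) y y u ^ 2)

/-- The density of the Busemann-Hausdorff volume form,
`σ(x) = Vol(unit ball of ℝⁿ) / Vol{y | F(x, y) < 1}`. -/
def bhDensity (L : Coord n → Coord n → ℝ) (x : Coord n) : ℝ :=
  (MeasureTheory.volume (Metric.ball (0 : Coord n) 1)).toReal /
    (MeasureTheory.volume {y : Coord n | L x y < 1}).toReal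

/-- The distortion `τ(x, y) = log (√det(g_{ij}(x, y)) / σ(x))`. -/
def distortion (L : Coord n → Coord n → ℝ) (x y : Coord n) : ℝ :=
  Real.log (Real.sqrt (gMat L x y).det / bhDensity L x)

/-- The spray coefficients as a vector. -/
def sprayVec (L : Coord n → Coord n → ℝ) (x y : Coord n) : Coord n :=
  WithLp.toLp 2 fun i => spray L i x y

/-- The `S`-curvature: the derivative of the distortion along geodesics, that is, along the
geodesic spray `yⁱ ∂/∂xⁱ - 2 Gⁱ ∂/∂yⁱ`; see `hasDerivAt_distortion_geodesic`. -/
def sCurvature (L : Coord n → Coord n → ℝ) (x y : Coord n) : ℝ :=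
  fderiv ℝ (fun q : Coord n × Coord n => distortion L q.1 q.2) (x, y)
    (y, -(2 : ℝ) • sprayVec L x y)

/-- If `c` is a geodesic (`c'' + 2 G(c, c') = 0`), then the derivative of `τ(c(t), c'(t))` is the
`S`-curvature at `(c(t), c'(t))`. -/
theorem hasDerivAt_distortion_geodesic (L : Coord n → Coord n → ℝ) (c c' : ℝ → Coord n) (t : ℝ)
    (hc : HasDerivAt c (c' t) t)
    (hc' : HasDerivAt c' (-(2 : ℝ) • sprayVec L (c t) (c' t)) t)
    (hd : DifferentiableAt ℝ (fun q : Coord n × Coord n => distortion L q.1 q.2) (c t, c' t)) :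
    HasDerivAt (fun s => distortion L (c s) (c' s)) (sCurvature L (c t) (c' t)) t :=
  HasFDerivAt.comp_hasDerivAt (f := fun s => (c s, c' s)) t hd.hasFDerivAt (hc.prodMk hc')

/-- The Berwald curvature `B_j{}ⁱ{}_{kl} = ∂³Gⁱ/∂yʲ∂yᵏ∂yˡ`; the upper index comes first. -/
def berwald (L : Coord n → Coord n → ℝ) (i j k l : Fin n) : Coord n → Coord n → ℝ :=
  dy l (dy k (dy j (spray L i)))

/-- The mean Berwald curvature `E_{jk} = (1/2) B_j{}ᵐ{}_{km}`. -/
def meanBerwald (L : Coord n → Coord n → ℝ) (j k : Fin n) : Coord n → Coord n → ℝ :=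
  fun x y => (1 / 2) * ∑ m, berwald L m j k m x y

/-- The Douglas tensor
`D_j{}ⁱ{}_{kl} = B_j{}ⁱ{}_{kl} - (1/(n+1)) ∂³/∂yʲ∂yᵏ∂yˡ ((∂Gᵐ/∂yᵐ) yⁱ)`;
the upper index comes first. -/
def douglas (L : Coord n → Coord n → ℝ) (i j k l : Fin n) : Coord n → Coord n → ℝ :=
  fun x y => berwald L i j k l x y
    - (1 / ((n : ℝ) + 1)) *
      dy l (dy k (dy j (fun x y => (∑ m, dy m (spray L m) x y) * y i))) x y

/-- The horizontal derivative `δf/δxᵐ = ∂f/∂xᵐ - Nʳ_m ∂f/∂yʳ`. -/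
def horDeriv (L : Coord n → Coord n → ℝ) (m : Fin n) (f : Coord n → Coord n → ℝ) :
    Coord n → Coord n → ℝ :=
  fun x y => dx m f x y - ∑ r, nonlinConn L r m x y * dy r f x y

/-- The horizontal covariant derivative `T_{jk|m}` of a tensor `T_{jk}` with respect to the
Berwald connection. -/
def horCov02 (L : Coord n → Coord n → ℝ) (T : Fin n → Fin n → Coord n → Coord n → ℝ)
    (j k m : Fin n) : Coord n → Coord n → ℝ :=
  fun x y => horDeriv L m (T j k) x y
    - ∑ r, T r k x y * berwaldConn L r j m x y
    - ∑ r, T j r x y * berwaldConn L r k m x y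

/-- The horizontal covariant derivative `T_j{}ⁱ{}_{kl|m}` of a tensor `T_j{}ⁱ{}_{kl}` (upper index
first) with respect to the Berwald connection. -/
def horCov13 (L : Coord n → Coord n → ℝ)
    (T : Fin n → Fin n → Fin n → Fin n → Coord n → Coord n → ℝ)
    (i j k l m : Fin n) : Coord n → Coord n → ℝ :=
  fun x y => horDeriv L m (T i j k l) x y
    + ∑ r, T r j k l x y * berwaldConn L i r m x y
    - ∑ r, T i r k l x y * berwaldConn L r j m x y
    - ∑ r, T i j r l x y * berwaldConn L r k m x y
    - ∑ r, T i j k r x y * berwaldConn L r l m x y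

/-- The contraction `T_j{}ⁱ{}_{kl|0} = T_j{}ⁱ{}_{kl|m} yᵐ`. -/
def horCov13Zero (L : Coord n → Coord n → ℝ)
    (T : Fin n → Fin n → Fin n → Fin n → Coord n → Coord n → ℝ)
    (i j k l : Fin n) : Coord n → Coord n → ℝ :=
  fun x y => ∑ m, horCov13 L T i j k l m x y * y m

/-- The tensor `D̃_j{}ⁱ{}_{kl} = D_j{}ⁱ{}_{kl|m} yᵐ`. -/
def dTilde (L : Coord n → Coord n → ℝ) (i j k l : Fin n) : Coord n → Coord n → ℝ :=
  horCov13Zero L (douglas L) i j k l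

/-- The Ricci scalar `R = (1/(n-1)) Rᵐ_m`. -/
def ricciScalar (L : Coord n → Coord n → ℝ) : Coord n → Coord n → ℝ :=
  fun x y => (1 / ((n : ℝ) - 1)) * ∑ m, riemann L m m x y

/-- `θ_{jkl} = 2 E_{jk|l} - (1/3) (Rˢ_{l.s} - (n+2) R_{.l})_{.j.k}`. -/
def theta (L : Coord n → Coord n → ℝ) (j k l : Fin n) : Coord n → Coord n → ℝ :=
  fun x y => 2 * horCov02 L (meanBerwald L) j k l x y
    - (1 / 3) * dy k (dy j (fun x y =>
        (∑ s, dy s (riemann L s l) x y) - ((n : ℝ) + 2) * dy l (ricciScalar L) x y)) x y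

end LocalQuantities

/-! ### Finsler metrics on manifolds -/

section Manifolds

variable {n : ℕ} {M : Type*} [TopologicalSpace M] [ChartedSpace (Coord n) M]

/-- The expression `f(x, y)` in the chart `e` of a function `f` on `TM`: `x` ranges over
`e.target`, and `y` stands for the tangent vector `yⁱ ∂/∂xⁱ`. -/
def localRep (f : TangentBundle (𝓡 n) M → ℝ) (e : OpenPartialHomeomorph M (Coord n)) :
    Coord n → Coord n → ℝ :=
  fun x y => f ⟨e.symm x, mfderiv (𝓡 n) (𝓡 n) e.symm x y⟩

/-- The component `μ_r(x, y)` in the chart `e` of a field `μ` of covectors of `M` which depends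
on a tangent vector, `μ = μ_r(x, y) dxʳ`. -/
def localCovec (μ : (v : TangentBundle (𝓡 n) M) → TangentSpace (𝓡 n) v.proj →L[ℝ] ℝ)
    (e : OpenPartialHomeomorph M (Coord n)) (r : Fin n) : Coord n → Coord n → ℝ :=
  fun x y => μ ⟨e.symm x, mfderiv (𝓡 n) (𝓡 n) e.symm x y⟩
    (mfderiv (𝓡 n) (𝓡 n) e.symm x (coordVec r : Coord n))

/-- A property of coordinate expressions holds at every point of the slit tangent bundle, in all
charts of the atlas. -/
def EverywhereOnSlit (M : Type*) [TopologicalSpace M] [ChartedSpace (Coord n) M]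
    (P : OpenPartialHomeomorph M (Coord n) → Coord n → Coord n → Prop) : Prop :=
  ∀ e ∈ atlas (Coord n) M, ∀ x ∈ e.target, ∀ y : Coord n, y ≠ 0 → P e x y

variable [IsManifold (𝓡 n) ∞ M]

/-- `F` is a Finsler metric on `M`. -/
structure IsFinslerMetric (F : TangentBundle (𝓡 n) M → ℝ) : Prop where
  nonneg : ∀ v, 0 ≤ F v
  smooth : ContMDiffOn (𝓡 n).tangent 𝓘(ℝ, ℝ) ∞ F {v | v.2 ≠ 0}
  homogeneous : ∀ (p : M) (y : TangentSpace (𝓡 n) p) (c : ℝ), 0 < c →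
    F ⟨p, c • y⟩ = c * F ⟨p, y⟩
  posDef : ∀ (p : M) (y u : TangentSpace (𝓡 n) p), y ≠ 0 → u ≠ 0 →
    0 < fundForm (fun w : TangentSpace (𝓡 n) p => F ⟨p, w⟩) y u u

/-- The Douglas tensor of `F` vanishes. -/
def DouglasVanishes (F : TangentBundle (𝓡 n) M → ℝ) : Prop :=
  EverywhereOnSlit M fun e x y => ∀ i j k l, douglas (localRep F e) i j k l x y = 0

/-- The tensor `D̃` of `F` vanishes. -/
def DTildeVanishes (F : TangentBundle (𝓡 n) M → ℝ) : Prop :=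
  EverywhereOnSlit M fun e x y => ∀ i j k l, dTilde (localRep F e) i j k l x y = 0

/-- The quantity `θ` of `F` vanishes. -/
def ThetaVanishes (F : TangentBundle (𝓡 n) M → ℝ) : Prop :=
  EverywhereOnSlit M fun e x y => ∀ j k l, theta (localRep F e) j k l x y = 0

/-- `F` has vanishing flag curvature, `K = 0`. -/
def FlagCurvatureVanishes (F : TangentBundle (𝓡 n) M → ℝ) : Prop :=
  EverywhereOnSlit M fun e x y => ∀ u : Coord n, LinearIndependent ℝ ![y, u] →
    flagCurvature (localRep F e) x y u = 0

/-- `F` has vanishing `S`-curvature (the distortion is differentiable and its derivative along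
the geodesics is zero). -/
def SCurvatureVanishes (F : TangentBundle (𝓡 n) M → ℝ) : Prop :=
  EverywhereOnSlit M fun e x y =>
    DifferentiableAt ℝ (fun q : Coord n × Coord n => distortion (localRep F e) q.1 q.2) (x, y) ∧
      sCurvature (localRep F e) x y = 0

/-- `F` is a Douglas metric. -/
def IsDouglasMetric (F : TangentBundle (𝓡 n) M → ℝ) : Prop :=
  IsFinslerMetric F ∧ DouglasVanishes F

/-- `F` is a generalized `D̃`-metric: `D̃_j{}ⁱ{}_{kl|0} + μ_r D̃_j{}ʳ{}_{kl} yⁱ = 0` for some smooth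
tensor `μ = μ_r dxʳ` on the slit tangent bundle. -/
def IsGeneralizedDTildeMetric (F : TangentBundle (𝓡 n) M → ℝ) : Prop :=
  IsFinslerMetric F ∧
    ∃ μ : (v : TangentBundle (𝓡 n) M) → TangentSpace (𝓡 n) v.proj →L[ℝ] ℝ,
      (∀ e ∈ atlas (Coord n) M, ∀ r,
        ContDiffOn ℝ ∞ (fun q : Coord n × Coord n => localCovec μ e r q.1 q.2)
          (e.target ×ˢ {y | y ≠ 0})) ∧
      EverywhereOnSlit M fun e x y => ∀ i j k l,
        horCov13Zero (localRep F e) (dTilde (localRep F e)) i j k l x y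
          + (∑ r, localCovec μ e r x y * dTilde (localRep F e) r j k l x y) * y i = 0

/-- `α(x, y) = √(a_x(y, y))` for a smooth Riemannian metric `a` on `M`. -/
structure IsRiemannianNorm (α : TangentBundle (𝓡 n) M → ℝ) : Prop where
  smooth_sq : ContMDiff (𝓡 n).tangent 𝓘(ℝ, ℝ) ∞ fun v => α v ^ 2
  exists_form : ∀ p : M,
    ∃ a : TangentSpace (𝓡 n) p →ₗ[ℝ] TangentSpace (𝓡 n) p →ₗ[ℝ] ℝ,
      (∀ u w, a u w = a w u) ∧ (∀ u, u ≠ 0 → 0 < a u u) ∧ ∀ y, α ⟨p, y⟩ = Real.sqrt (a y y)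

/-- `β` is a smooth 1-form on `M`, regarded as a function on `TM`. -/
structure IsOneForm (β : TangentBundle (𝓡 n) M → ℝ) : Prop where
  smooth : ContMDiff (𝓡 n).tangent 𝓘(ℝ, ℝ) ∞ β
  linear : ∀ p : M, IsLinearMap ℝ fun y : TangentSpace (𝓡 n) p => β ⟨p, y⟩

/-- The 1-form `β` is closed: `∂b_j/∂xⁱ = ∂b_i/∂xʲ` in the charts, where `β = b_i dxⁱ`. -/
def IsClosedOneForm (β : TangentBundle (𝓡 n) M → ℝ) : Prop :=
  ∀ e ∈ atlas (Coord n) M, ∀ x ∈ e.target, ∀ i j : Fin n,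
    lineDeriv ℝ (fun x' => localRep β e x' (coordVec j)) x (coordVec i) =
      lineDeriv ℝ (fun x' => localRep β e x' (coordVec i)) x (coordVec j)

/-- `F = α + β` is a Randers metric: `α` is Riemannian, `β` is a 1-form, and `‖β‖_α < 1` at every
point. -/
structure IsRandersMetric (F α β : TangentBundle (𝓡 n) M → ℝ) : Prop where
  eq_add : ∀ v, F v = α v + β v
  riemannian : IsRiemannianNorm α
  oneForm : IsOneForm β
  norm_lt_one : ∀ v, v.2 ≠ 0 → |β v| < α v

end Manifolds

/-! ### The Randers metric on the unit ball of `ℝ³` -/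

/-- The open unit ball `Ω` of `ℝ³`. -/
def unitBall : TopologicalSpace.Opens (Coord 3) := ⟨Metric.ball 0 1, Metric.isOpen_ball⟩

/-- `α = √((-y u + x v)² + (u² + v² + w²) (1 - x² - y²)) / (1 - x² - y²)`
at the point `(x, y, z)` and the tangent vector `(u, v, w)`. -/
def ballAlpha (q : TangentBundle (𝓡 3) unitBall) : ℝ :=
  let p : Coord 3 := q.1
  let t : Coord 3 := q.2
  Real.sqrt ((-(p 1) * t 0 + p 0 * t 1) ^ 2
      + (t 0 ^ 2 + t 1 ^ 2 + t 2 ^ 2) * (1 - p 0 ^ 2 - p 1 ^ 2)) / (1 - p 0 ^ 2 - p 1 ^ 2)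

/-- `β = (-y u + x v) / (1 - x² - y²)`. -/
def ballBeta (q : TangentBundle (𝓡 3) unitBall) : ℝ :=
  let p : Coord 3 := q.1
  let t : Coord 3 := q.2
  (-(p 1) * t 0 + p 0 * t 1) / (1 - p 0 ^ 2 - p 1 ^ 2)

/-- The metric `F = α + β`. -/
def ballRanders (q : TangentBundle (𝓡 3) unitBall) : ℝ := ballAlpha q + ballBeta q

end

end FinslerGeom

/-! Part (1) is locality: if `D` vanishes on the slit bundle, which is open, then so do its
derivatives, hence `D̃ = 0`, and `μ = 0` satisfies the defining equation. The same choice of `μ`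
settles the example once `D̃ = 0` is known there.

Part (2) rests on Zermelo navigation. Let `W(x) = rot x`, a Euclidean Killing field. The metric `F`
is the positive root of `|y - F W|² = F²`: its unit ball is the Euclidean unit ball translated by
`W`. Geodesics of unit speed are straight lines carried by the flow of `W`, `c(t) = exp(t rot)(a + t
v)`, so `c'' = 2 rot c' - rot² c`; restoring homogeneity gives `G = -F rot y + (1/2) F² rot² x`.
This candidate is verified by the Euler-Lagrange equation (`gMat_mulVec_navSpray`, `spray_navF`).
Write `V = y - F W`, `D` for the square root `navRoot` (which equals `F + ⟨V, W⟩`), and `p = V / D =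
∂F/∂y`. Along the spray `F` and `D` are constant, while `V` and `p` rotate at rate `F`.

These laws give `R = 0` (`riemann_eq_zero`), hence `K = 0`. The volume density is constant because
translation preserves volume, and `det g = (F/D)⁴` is constant along geodesics, so `S = 0`. Skewness
of `rot` gives `∂Gᵐ/∂yᵐ = 0`; hence `E = 0`, `θ = 0`, and `D_j{}ⁱ{}_{kl}` coincides with the Berwald
curvature.

The general fact behind `D̃ = 0` is `horCov13Zero_berwald_eq_zero`: for a spray with `R = 0`, the
Berwald curvature satisfies `B_{|0} = 0`. It is proved by differentiating the equation `R = 0` twice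
in `y`. Finally `B ≠ 0` at the centre, where `G⁰ = -|y| y¹` is not quadratic in `y`. -/

namespace FinslerGeom

noncomputable section

/-! ### Directional, horizontal and vertical derivatives on open sets of `(x, y)`. -/

section JetCalculus

variable {n : ℕ}

/-- A function of position and direction, as a function on the product. -/
abbrev joint (f : Coord n → Coord n → ℝ) : Coord n × Coord n → ℝ := fun q => f q.1 q.2

/-- The derivative of `f` at `(x, y)` in the direction `(a, b)`. -/
def dirDeriv (f : Coord n → Coord n → ℝ) (x y a b : Coord n) : ℝ :=
  fderiv ℝ (joint f) (x, y) (a, b)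

theorem hasDerivAt_dirDeriv {f : Coord n → Coord n → ℝ} {x y : Coord n}
    (hf : DifferentiableAt ℝ (joint f) (x, y)) (a b : Coord n) :
    HasDerivAt (fun t : ℝ => f (x + t • a) (y + t • b)) (dirDeriv f x y a b) 0 := by
  have h := hf.hasFDerivAt.hasLineDerivAt (a, b)
  simpa [HasLineDerivAt, dirDeriv] using h

theorem dx_eq_dirDeriv {f : Coord n → Coord n → ℝ} {x y : Coord n}
    (hf : DifferentiableAt ℝ (joint f) (x, y)) (i : Fin n) :
    dx i f x y = dirDeriv f x y (coordVec i) 0 := by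
  have h := (hasDerivAt_dirDeriv hf (coordVec i) 0).deriv
  simpa [dx, lineDeriv] using h

theorem dy_eq_dirDeriv {f : Coord n → Coord n → ℝ} {x y : Coord n}
    (hf : DifferentiableAt ℝ (joint f) (x, y)) (i : Fin n) :
    dy i f x y = dirDeriv f x y 0 (coordVec i) := by
  have h := (hasDerivAt_dirDeriv hf 0 (coordVec i)).deriv
  simpa [dy, lineDeriv] using h

theorem sum_smul_coordVec (a : Coord n) : ∑ i, a i • coordVec i = a := by
  ext j
  simp [coordVec, Pi.single_apply]

theorem dirDeriv_eq_sum {f : Coord n → Coord n → ℝ} {x y : Coord n}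
    (hf : DifferentiableAt ℝ (joint f) (x, y)) (a b : Coord n) :
    dirDeriv f x y a b = ∑ i, a i * dx i f x y + ∑ i, b i * dy i f x y := by
  have h1 : ((a, b) : Coord n × Coord n)
      = ∑ i, a i • ((coordVec i : Coord n), (0 : Coord n))
        + ∑ i, b i • ((0 : Coord n), (coordVec i : Coord n)) := by
    refine Prod.ext ?_ ?_ <;> simp [Prod.fst_sum, Prod.snd_sum, sum_smul_coordVec]
  simp only [dx_eq_dirDeriv hf, dy_eq_dirDeriv hf]
  rw [dirDeriv, h1]
  simp only [map_add, map_sum, map_smul, smul_eq_mul, dirDeriv]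

variable {U : Set (Coord n × Coord n)}

theorem dx_congr (hU : IsOpen U) {f g : Coord n → Coord n → ℝ}
    (h : ∀ x y, (x, y) ∈ U → f x y = g x y) (i : Fin n) {x y : Coord n} (hx : (x, y) ∈ U) :
    dx i f x y = dx i g x y := by
  refine Filter.EventuallyEq.lineDeriv_eq ?_
  have : ∀ᶠ x' in nhds x, (x', y) ∈ U :=
    (Continuous.prodMk_left y).continuousAt.eventually (hU.mem_nhds hx)
  exact this.mono fun x' hx' => h x' y hx'

theorem dy_congr (hU : IsOpen U) {f g : Coord n → Coord n → ℝ}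
    (h : ∀ x y, (x, y) ∈ U → f x y = g x y) (i : Fin n) {x y : Coord n} (hx : (x, y) ∈ U) :
    dy i f x y = dy i g x y := by
  refine Filter.EventuallyEq.lineDeriv_eq ?_
  have : ∀ᶠ y' in nhds y, (x, y') ∈ U :=
    (Continuous.prodMk_right x).continuousAt.eventually (hU.mem_nhds hx)
  exact this.mono fun y' hy' => h x y' hy'

theorem dx_zero (i : Fin n) (x y : Coord n) : dx i (fun _ _ => 0) x y = 0 := by
  simp [dx, lineDeriv]

theorem dy_zero (i : Fin n) (x y : Coord n) : dy i (fun _ _ => 0) x y = 0 := by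
  simp [dy, lineDeriv]

theorem dx_eq_zero (hU : IsOpen U) {f : Coord n → Coord n → ℝ}
    (h : ∀ x y, (x, y) ∈ U → f x y = 0) (i : Fin n) {x y : Coord n} (hx : (x, y) ∈ U) :
    dx i f x y = 0 :=
  (dx_congr hU h i hx).trans (dx_zero i x y)

theorem dy_eq_zero (hU : IsOpen U) {f : Coord n → Coord n → ℝ}
    (h : ∀ x y, (x, y) ∈ U → f x y = 0) (i : Fin n) {x y : Coord n} (hx : (x, y) ∈ U) :
    dy i f x y = 0 :=
  (dy_congr hU h i hx).trans (dy_zero i x y)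

theorem differentiableAt_joint (hU : IsOpen U) {f : Coord n → Coord n → ℝ}
    (hf : ContDiffOn ℝ ∞ (joint f) U) {x y : Coord n} (hx : (x, y) ∈ U) :
    DifferentiableAt ℝ (joint f) (x, y) :=
  (hf.contDiffAt (hU.mem_nhds hx)).differentiableAt (by simp)

theorem contDiffOn_fderiv_apply (hU : IsOpen U) {φ : Coord n × Coord n → ℝ}
    (hf : ContDiffOn ℝ ∞ φ U) (v : Coord n × Coord n) :
    ContDiffOn ℝ ∞ (fun q => fderiv ℝ φ q v) U :=
  (hf.fderiv_of_isOpen hU (by simp)).clm_apply contDiffOn_const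

theorem contDiffOn_dx (hU : IsOpen U) {f : Coord n → Coord n → ℝ}
    (hf : ContDiffOn ℝ ∞ (joint f) U) (i : Fin n) : ContDiffOn ℝ ∞ (joint (dx i f)) U :=
  (contDiffOn_fderiv_apply hU hf (coordVec i, 0)).congr fun _ hq =>
    dx_eq_dirDeriv (differentiableAt_joint hU hf hq) i

theorem contDiffOn_dy (hU : IsOpen U) {f : Coord n → Coord n → ℝ}
    (hf : ContDiffOn ℝ ∞ (joint f) U) (i : Fin n) : ContDiffOn ℝ ∞ (joint (dy i f)) U :=
  (contDiffOn_fderiv_apply hU hf (0, coordVec i)).congr fun _ hq =>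
    dy_eq_dirDeriv (differentiableAt_joint hU hf hq) i

theorem fderiv_fderiv_apply_comm (hU : IsOpen U) {φ : Coord n × Coord n → ℝ}
    (hf : ContDiffOn ℝ ∞ φ U) {q : Coord n × Coord n} (hq : q ∈ U) (v w : Coord n × Coord n) :
    fderiv ℝ (fun q => fderiv ℝ φ q v) q w = fderiv ℝ (fun q => fderiv ℝ φ q w) q v := by
  have hc : ContDiffAt ℝ ∞ φ q := hf.contDiffAt (hU.mem_nhds hq)
  have hd : DifferentiableAt ℝ (fderiv ℝ φ) q :=
    (hc.fderiv_right (m := ∞) (by simp)).differentiableAt (by simp)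
  have hs : IsSymmSndFDerivAt ℝ φ q := hc.isSymmSndFDerivAt (by simpa using WithTop.coe_le_coe.2 (le_top : (2 : ℕ∞) ≤ ⊤))
  rw [fderiv_clm_apply hd (differentiableAt_const _), fderiv_clm_apply hd (differentiableAt_const _)]
  simpa using hs w v

theorem dirDeriv_congr (hU : IsOpen U) {f g : Coord n → Coord n → ℝ}
    (h : ∀ x y, (x, y) ∈ U → f x y = g x y) {x y : Coord n} (hx : (x, y) ∈ U) (a b : Coord n) :
    dirDeriv f x y a b = dirDeriv g x y a b := by
  have : joint f =ᶠ[nhds (x, y)] joint g :=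
    Filter.eventuallyEq_of_mem (hU.mem_nhds hx) fun q hq => h q.1 q.2 hq
  rw [dirDeriv, dirDeriv, this.fderiv_eq]

theorem dy_dy_comm (hU : IsOpen U) {f : Coord n → Coord n → ℝ}
    (hf : ContDiffOn ℝ ∞ (joint f) U) (i j : Fin n) {x y : Coord n} (hx : (x, y) ∈ U) :
    dy i (dy j f) x y = dy j (dy i f) x y := by
  rw [dy_eq_dirDeriv (differentiableAt_joint hU (contDiffOn_dy hU hf j) hx),
    dy_eq_dirDeriv (differentiableAt_joint hU (contDiffOn_dy hU hf i) hx),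
    dirDeriv_congr hU (fun x y h => dy_eq_dirDeriv (differentiableAt_joint hU hf h) j) hx,
    dirDeriv_congr hU (fun x y h => dy_eq_dirDeriv (differentiableAt_joint hU hf h) i) hx]
  exact fderiv_fderiv_apply_comm hU hf hx _ _

theorem dx_dy_comm (hU : IsOpen U) {f : Coord n → Coord n → ℝ}
    (hf : ContDiffOn ℝ ∞ (joint f) U) (i j : Fin n) {x y : Coord n} (hx : (x, y) ∈ U) :
    dx i (dy j f) x y = dy j (dx i f) x y := by
  rw [dx_eq_dirDeriv (differentiableAt_joint hU (contDiffOn_dy hU hf j) hx),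
    dy_eq_dirDeriv (differentiableAt_joint hU (contDiffOn_dx hU hf i) hx),
    dirDeriv_congr hU (fun x y h => dy_eq_dirDeriv (differentiableAt_joint hU hf h) j) hx,
    dirDeriv_congr hU (fun x y h => dx_eq_dirDeriv (differentiableAt_joint hU hf h) i) hx]
  exact fderiv_fderiv_apply_comm hU hf hx _ _

theorem dirDeriv_add {f g : Coord n → Coord n → ℝ} {x y : Coord n}
    (hf : DifferentiableAt ℝ (joint f) (x, y)) (hg : DifferentiableAt ℝ (joint g) (x, y))
    (a b : Coord n) :
    dirDeriv (fun x y => f x y + g x y) x y a b = dirDeriv f x y a b + dirDeriv g x y a b := by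
  simpa [dirDeriv] using congrArg (· (a, b)) (hf.hasFDerivAt.fun_add hg.hasFDerivAt).fderiv

theorem dirDeriv_sub {f g : Coord n → Coord n → ℝ} {x y : Coord n}
    (hf : DifferentiableAt ℝ (joint f) (x, y)) (hg : DifferentiableAt ℝ (joint g) (x, y))
    (a b : Coord n) :
    dirDeriv (fun x y => f x y - g x y) x y a b = dirDeriv f x y a b - dirDeriv g x y a b := by
  simpa [dirDeriv] using congrArg (· (a, b)) (hf.hasFDerivAt.fun_sub hg.hasFDerivAt).fderiv

theorem dirDeriv_mul {f g : Coord n → Coord n → ℝ} {x y : Coord n}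
    (hf : DifferentiableAt ℝ (joint f) (x, y)) (hg : DifferentiableAt ℝ (joint g) (x, y))
    (a b : Coord n) :
    dirDeriv (fun x y => f x y * g x y) x y a b
      = dirDeriv f x y a b * g x y + f x y * dirDeriv g x y a b := by
  have := congrArg (· (a, b)) (hf.hasFDerivAt.fun_mul hg.hasFDerivAt).fderiv
  simp [dirDeriv] at this ⊢
  rw [this]; ring

theorem dirDeriv_const_mul {f : Coord n → Coord n → ℝ} {x y : Coord n}
    (hf : DifferentiableAt ℝ (joint f) (x, y)) (c : ℝ) (a b : Coord n) :
    dirDeriv (fun x y => c * f x y) x y a b = c * dirDeriv f x y a b := by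
  simpa [dirDeriv] using congrArg (· (a, b)) (hf.hasFDerivAt.const_mul c).fderiv

theorem dirDeriv_sum {ι : Type*} (s : Finset ι) {f : ι → Coord n → Coord n → ℝ} {x y : Coord n}
    (hf : ∀ i ∈ s, DifferentiableAt ℝ (joint (f i)) (x, y)) (a b : Coord n) :
    dirDeriv (fun x y => ∑ i ∈ s, f i x y) x y a b = ∑ i ∈ s, dirDeriv (f i) x y a b := by
  have := congrArg (· (a, b)) (HasFDerivAt.fun_sum fun i hi => (hf i hi).hasFDerivAt).fderiv
  simpa [dirDeriv] using this

theorem contDiff_joint_snd (i : Fin n) : ContDiff ℝ ∞ (joint fun _ y => (y : Coord n) i) := by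
  fun_prop

theorem dirDeriv_snd (i : Fin n) (x y a b : Coord n) :
    dirDeriv (fun _ y => y i) x y a b = b i := by
  have h := hasDerivAt_dirDeriv (x := x) (y := y)
    ((contDiff_joint_snd i).contDiffAt.differentiableAt (by simp)) a b
  refine h.unique ?_
  simpa using ((hasDerivAt_id (0 : ℝ)).mul_const (b i)).const_add (y i)

end JetCalculus

/-! ### Differentiation along a spray; flat sprays and their Berwald curvature. -/

section SprayCalculus

variable {n : ℕ} {U : Set (Coord n × Coord n)}

theorem dy_add (hU : IsOpen U) {f g : Coord n → Coord n → ℝ}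
    (hf : ContDiffOn ℝ ∞ (joint f) U) (hg : ContDiffOn ℝ ∞ (joint g) U) (k : Fin n)
    {x y : Coord n} (hx : (x, y) ∈ U) :
    dy k (fun x y => f x y + g x y) x y = dy k f x y + dy k g x y := by
  have hf' := differentiableAt_joint hU hf hx
  have hg' := differentiableAt_joint hU hg hx
  rw [dy_eq_dirDeriv hf', dy_eq_dirDeriv hg', dy_eq_dirDeriv (hf'.add hg'), dirDeriv_add hf' hg']

theorem dy_sub (hU : IsOpen U) {f g : Coord n → Coord n → ℝ}
    (hf : ContDiffOn ℝ ∞ (joint f) U) (hg : ContDiffOn ℝ ∞ (joint g) U) (k : Fin n)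
    {x y : Coord n} (hx : (x, y) ∈ U) :
    dy k (fun x y => f x y - g x y) x y = dy k f x y - dy k g x y := by
  have hf' := differentiableAt_joint hU hf hx
  have hg' := differentiableAt_joint hU hg hx
  rw [dy_eq_dirDeriv hf', dy_eq_dirDeriv hg', dy_eq_dirDeriv (hf'.sub hg'), dirDeriv_sub hf' hg']

theorem dy_const_mul (hU : IsOpen U) {f : Coord n → Coord n → ℝ}
    (hf : ContDiffOn ℝ ∞ (joint f) U) (c : ℝ) (k : Fin n)
    {x y : Coord n} (hx : (x, y) ∈ U) :
    dy k (fun x y => c * f x y) x y = c * dy k f x y := by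
  have hf' := differentiableAt_joint hU hf hx
  rw [dy_eq_dirDeriv hf', dy_eq_dirDeriv (hf'.const_mul c), dirDeriv_const_mul hf']

theorem contDiffOn_joint_sum {ι : Type*} (s : Finset ι) {f : ι → Coord n → Coord n → ℝ}
    (hf : ∀ i, ContDiffOn ℝ ∞ (joint (f i)) U) :
    ContDiffOn ℝ ∞ (joint fun x y => ∑ i ∈ s, f i x y) U :=
  ContDiffOn.sum fun i _ => hf i

theorem dy_sum (hU : IsOpen U) {ι : Type*} (s : Finset ι) {f : ι → Coord n → Coord n → ℝ}
    (hf : ∀ i, ContDiffOn ℝ ∞ (joint (f i)) U) (k : Fin n)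
    {x y : Coord n} (hx : (x, y) ∈ U) :
    dy k (fun x y => ∑ i ∈ s, f i x y) x y = ∑ i ∈ s, dy k (f i) x y := by
  have hf' := fun i => differentiableAt_joint hU (hf i) hx
  rw [dy_eq_dirDeriv (differentiableAt_joint hU (contDiffOn_joint_sum s hf) hx),
    dirDeriv_sum s fun i _ => hf' i]
  exact Finset.sum_congr rfl fun i _ => (dy_eq_dirDeriv (hf' i) k).symm

theorem dy_sum_mul (hU : IsOpen U) {ι : Type*} (s : Finset ι) {f g : ι → Coord n → Coord n → ℝ}
    (hf : ∀ i, ContDiffOn ℝ ∞ (joint (f i)) U) (hg : ∀ i, ContDiffOn ℝ ∞ (joint (g i)) U)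
    (k : Fin n) {x y : Coord n} (hx : (x, y) ∈ U) :
    dy k (fun x y => ∑ i ∈ s, f i x y * g i x y) x y
      = ∑ i ∈ s, dy k (f i) x y * g i x y + ∑ i ∈ s, f i x y * dy k (g i) x y := by
  rw [dy_sum hU s (f := fun i x y => f i x y * g i x y) (fun i => (hf i).mul (hg i)) k hx,
    ← Finset.sum_add_distrib]
  refine Finset.sum_congr rfl fun i _ => ?_
  have hf' := differentiableAt_joint hU (hf i) hx
  have hg' := differentiableAt_joint hU (hg i) hx
  rw [dy_eq_dirDeriv hf', dy_eq_dirDeriv hg', dy_eq_dirDeriv (hf'.mul hg'), dirDeriv_mul hf' hg']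

/-- The derivative along the geodesic spray `yᵐ ∂/∂xᵐ - 2 Gᵐ ∂/∂yᵐ`. -/
def geodDeriv (L : Coord n → Coord n → ℝ) (f : Coord n → Coord n → ℝ) : Coord n → Coord n → ℝ :=
  fun x y => dirDeriv f x y y (-(2 : ℝ) • sprayVec L x y)

variable {L : Coord n → Coord n → ℝ}

theorem geodDeriv_eq_sum {f : Coord n → Coord n → ℝ} {x y : Coord n}
    (hf : DifferentiableAt ℝ (joint f) (x, y)) :
    geodDeriv L f x y = ∑ m, y m * dx m f x y - 2 * ∑ m, spray L m x y * dy m f x y := by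
  rw [geodDeriv, dirDeriv_eq_sum hf, Finset.mul_sum, sub_eq_add_neg, ← Finset.sum_neg_distrib]
  congr 1
  refine Finset.sum_congr rfl fun m _ => ?_
  simp [sprayVec]
  ring

/-- The commutator of `∂/∂yᵏ` with the spray `S = yᵐ ∂/∂xᵐ - 2 Gᵐ ∂/∂yᵐ` comes from differentiating
the coefficients of `S` only, since partial derivatives commute. -/
theorem dy_geodDeriv (hU : IsOpen U) (hG : ∀ i, ContDiffOn ℝ ∞ (joint (spray L i)) U)
    {f : Coord n → Coord n → ℝ} (hf : ContDiffOn ℝ ∞ (joint f) U) (k : Fin n)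
    {x y : Coord n} (hx : (x, y) ∈ U) :
    dy k (geodDeriv L f) x y = geodDeriv L (dy k f) x y + dx k f x y
      - 2 * ∑ m, dy k (spray L m) x y * dy m f x y := by
  have hX := fun m => contDiffOn_dx hU hf m
  have hY := fun m => contDiffOn_dy hU hf m
  have hs : ∀ m : Fin n, ContDiffOn ℝ ∞ (joint fun _ y => (y : Coord n) m) U :=
    fun m => (contDiff_joint_snd m).contDiffOn
  have h1 := contDiffOn_joint_sum Finset.univ (f := fun m x y => y m * dx m f x y)
    fun m => (hs m).mul (hX m)
  have h2 := contDiffOn_joint_sum Finset.univ (f := fun m x y => spray L m x y * dy m f x y)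
    fun m => (hG m).mul (hY m)
  rw [dy_congr hU (fun x y h => geodDeriv_eq_sum (differentiableAt_joint hU hf h)) k hx,
    geodDeriv_eq_sum (differentiableAt_joint hU (contDiffOn_dy hU hf k) hx)]
  rw [dy_sub hU (f := fun x y => ∑ m, y m * dx m f x y)
    (g := fun x y => 2 * ∑ m, spray L m x y * dy m f x y) h1 (contDiffOn_const.mul h2) k hx,
    dy_const_mul hU (f := fun x y => ∑ m, spray L m x y * dy m f x y) h2 2 k hx,
    dy_sum_mul hU Finset.univ hs hX k hx, dy_sum_mul hU Finset.univ hG hY k hx]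
  have e1 : ∑ m, dy k (fun _ y => (y : Coord n) m) x y * dx m f x y = dx k f x y := by
    have : ∀ m, dy k (fun _ y => (y : Coord n) m) x y = if m = k then 1 else 0 := fun m => by
      rw [dy_eq_dirDeriv (differentiableAt_joint hU (hs m) hx), dirDeriv_snd]
      simp [coordVec]
    simp [this]
  simp only [e1, fun m => dx_dy_comm hU hf m k hx, fun m => dy_dy_comm hU hf k m hx]
  ring

/-- The terms of `Rⁱ_k` containing `yᵐ` and `Gᵐ` undifferentiated assemble into the derivative of
`Nⁱ_k` along the spray. In this form `R = 0` is a transport equation for `N`. -/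
theorem riemann_eq (hU : IsOpen U) (hG : ∀ i, ContDiffOn ℝ ∞ (joint (spray L i)) U)
    (i k : Fin n) {x y : Coord n} (hx : (x, y) ∈ U) :
    riemann L i k x y = 2 * dx k (spray L i) x y - geodDeriv L (dy k (spray L i)) x y
      - ∑ m, dy m (spray L i) x y * dy k (spray L m) x y := by
  rw [geodDeriv_eq_sum (differentiableAt_joint hU (contDiffOn_dy hU (hG i) k) hx), riemann]
  simp only [mul_comm (y _)]
  ring

/-- Differentiate Euler's identity `yᵐ Nⁱ_m = 2 Gⁱ` in `yʳ`. -/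
theorem sum_berwaldConn_mul (hU : IsOpen U) (hG : ∀ i, ContDiffOn ℝ ∞ (joint (spray L i)) U)
    (hE : ∀ i x y, (x, y) ∈ U → ∑ m, y m * dy m (spray L i) x y = 2 * spray L i x y)
    (i r : Fin n) {x y : Coord n} (hx : (x, y) ∈ U) :
    ∑ m, berwaldConn L i r m x y * y m = dy r (spray L i) x y := by
  have hs : ∀ m : Fin n, ContDiffOn ℝ ∞ (joint fun _ y => (y : Coord n) m) U :=
    fun m => (contDiff_joint_snd m).contDiffOn
  have h := dy_congr hU (hE i) r hx
  rw [dy_const_mul hU (hG i) 2 r hx,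
    dy_sum_mul hU Finset.univ hs (fun m => contDiffOn_dy hU (hG i) m) r hx] at h
  have e1 : ∑ m, dy r (fun _ y => (y : Coord n) m) x y * dy m (spray L i) x y
      = dy r (spray L i) x y := by
    have : ∀ m, dy r (fun _ y => (y : Coord n) m) x y = if m = r then 1 else 0 := fun m => by
      rw [dy_eq_dirDeriv (differentiableAt_joint hU (hs m) hx), dirDeriv_snd]
      simp [coordVec]
    simp [this]
  rw [e1] at h
  have e2 : ∑ m, berwaldConn L i r m x y * y m = ∑ m, y m * dy r (dy m (spray L i)) x y :=
    Finset.sum_congr rfl fun m _ => by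
      rw [dy_dy_comm hU (hG i) r m hx, mul_comm, berwaldConn]
  rw [e2]
  linarith

/-- Euler's identity turns `Nʳ_m yᵐ` into `2 Gʳ` and `Γⁱ_{rm} yᵐ` into `Nⁱ_r`, so the contracted
covariant derivative is the spray derivative with corrections by `N`. -/
theorem horCov13Zero_eq (hU : IsOpen U) (hG : ∀ i, ContDiffOn ℝ ∞ (joint (spray L i)) U)
    (hE : ∀ i x y, (x, y) ∈ U → ∑ m, y m * dy m (spray L i) x y = 2 * spray L i x y)
    {T : Fin n → Fin n → Fin n → Fin n → Coord n → Coord n → ℝ}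
    (hT : ∀ i j k l, ContDiffOn ℝ ∞ (joint (T i j k l)) U)
    (i j k l : Fin n) {x y : Coord n} (hx : (x, y) ∈ U) :
    horCov13Zero L T i j k l x y = geodDeriv L (T i j k l) x y
      + ∑ r, T r j k l x y * dy r (spray L i) x y
      - ∑ r, T i r k l x y * dy j (spray L r) x y
      - ∑ r, T i j r l x y * dy k (spray L r) x y
      - ∑ r, T i j k r x y * dy l (spray L r) x y := by
  have hsum : ∀ (t : Fin n → ℝ) (c : Fin n → Fin n → ℝ),
      ∑ m, (∑ r, t r * c r m) * y m = ∑ r, t r * ∑ m, c r m * y m := fun t c => by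
    simp only [Finset.sum_mul, Finset.mul_sum]
    rw [Finset.sum_comm]
    simp only [mul_assoc]
  have hb := fun i r => sum_berwaldConn_mul hU hG hE i r hx
  simp only [horCov13Zero, horCov13, horDeriv, nonlinConn, sub_mul, add_mul,
    Finset.sum_sub_distrib, Finset.sum_add_distrib]
  rw [geodDeriv_eq_sum (differentiableAt_joint hU (hT i j k l) hx)]
  rw [hsum _ fun r m => berwaldConn L i r m x y, hsum _ fun r m => berwaldConn L r j m x y,
    hsum _ fun r m => berwaldConn L r k m x y, hsum _ fun r m => berwaldConn L r l m x y]
  simp only [hb]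
  have e : ∑ m, (∑ r, dy m (spray L r) x y * dy r (T i j k l) x y) * y m
      = 2 * ∑ m, spray L m x y * dy m (T i j k l) x y := by
    simp only [mul_comm (dy _ (spray L _) x y)]
    rw [hsum _ fun r m => dy m (spray L r) x y, Finset.mul_sum]
    refine Finset.sum_congr rfl fun r _ => ?_
    have := hE r x y hx
    simp only [mul_comm (dy _ (spray L _) x y), this]
    ring
  rw [e]
  simp only [mul_comm (y _)]

/-- If the Riemann curvature of a spray vanishes, then its Berwald curvature is constant along
geodesics. -/
theorem horCov13Zero_berwald_eq_zero (hU : IsOpen U)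
    (hG : ∀ i, ContDiffOn ℝ ∞ (joint (spray L i)) U)
    (hE : ∀ i x y, (x, y) ∈ U → ∑ m, y m * dy m (spray L i) x y = 2 * spray L i x y)
    (hR : ∀ i k x y, (x, y) ∈ U → riemann L i k x y = 0)
    (i j k l : Fin n) {x y : Coord n} (hx : (x, y) ∈ U) :
    horCov13Zero L (berwald L) i j k l x y = 0 := by
  have hN := fun i j => contDiffOn_dy hU (hG i) j
  have hΓ := fun i j k => contDiffOn_dy hU (hN i j) k
  have hB := fun i j k l => contDiffOn_dy hU (hΓ i j k) l
  have hXG := fun i k => contDiffOn_dx hU (hG i) k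
  have hXN := fun i j k => contDiffOn_dx hU (hN i j) k
  have hNN : ∀ i k, ContDiffOn ℝ ∞
      (joint fun x y => ∑ m, dy m (spray L i) x y * dy k (spray L m) x y) U := fun i k =>
    contDiffOn_joint_sum Finset.univ fun m => (hN i m).mul (hN m k)
  have hNΓ : ∀ i k l, ContDiffOn ℝ ∞
      (joint fun x y => ∑ m, dy k (spray L m) x y * dy m (dy l (spray L i)) x y) U := fun i k l =>
    contDiffOn_joint_sum Finset.univ fun m => (hN m k).mul (hΓ i l m)
  have hNΓ' : ∀ i k l, ContDiffOn ℝ ∞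
      (joint fun x y => ∑ m, dy m (spray L i) x y * dy l (dy k (spray L m)) x y) U := fun i k l =>
    contDiffOn_joint_sum Finset.univ fun m => (hN i m).mul (hΓ m k l)
  have hsym : ∀ i j k x y, (x, y) ∈ U →
      dy k (dy j (spray L i)) x y = dy j (dy k (spray L i)) x y :=
    fun i j k x y h => dy_dy_comm hU (hG i) k j h
  -- `R = 0` read as the transport equation for `N`; `hSΓ` is its first vertical derivative.
  have hSN : ∀ i k x y, (x, y) ∈ U → geodDeriv L (dy k (spray L i)) x y
      = 2 * dx k (spray L i) x y - ∑ m, dy m (spray L i) x y * dy k (spray L m) x y :=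
    fun i k x y h => by
      have := hR i k x y h
      rw [riemann_eq hU hG i k h] at this
      linarith
  have hSΓ : ∀ i k l x y, (x, y) ∈ U →
      geodDeriv L (dy l (dy k (spray L i))) x y = 2 * dx k (dy l (spray L i)) x y
        - dx l (dy k (spray L i)) x y
        + 2 * ∑ m, dy l (spray L m) x y * dy m (dy k (spray L i)) x y
        - ∑ m, dy k (spray L m) x y * dy m (dy l (spray L i)) x y
        - ∑ m, dy m (spray L i) x y * dy l (dy k (spray L m)) x y := fun i k l x y h => by
    have h1 := dy_congr hU (hSN i k) l h
    rw [dy_geodDeriv hU hG (hN i k) l h,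
      dy_sub hU (f := fun x y => 2 * dx k (spray L i) x y) (contDiffOn_const.mul (hXG i k))
        (hNN i k) l h,
      dy_const_mul hU (hXG i k) 2 l h, dy_sum_mul hU Finset.univ (hN i) (fun m => hN m k) l h,
      ← dx_dy_comm hU (hG i) k l h] at h1
    have h2 : ∑ m, dy l (dy m (spray L i)) x y * dy k (spray L m) x y
        = ∑ m, dy k (spray L m) x y * dy m (dy l (spray L i)) x y :=
      Finset.sum_congr rfl fun m _ => by rw [hsym i m l x y h, mul_comm]
    rw [h2] at h1
    linarith
  -- Integrability of the horizontal distribution, `δ_l Nⁱ_k = δ_k Nⁱ_l`. The left side and the last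
  -- sum of `hSΓ` are symmetric in `k, l`, so antisymmetrizing leaves three times this identity.
  have hH : ∀ i k l x y, (x, y) ∈ U →
      dx l (dy k (spray L i)) x y - dx k (dy l (spray L i)) x y
        = ∑ m, dy l (spray L m) x y * dy m (dy k (spray L i)) x y
          - ∑ m, dy k (spray L m) x y * dy m (dy l (spray L i)) x y := fun i k l x y h => by
    have h1 := hSΓ i k l x y h
    have h2 := hSΓ i l k x y h
    have h3 : geodDeriv L (dy l (dy k (spray L i))) x y
        = geodDeriv L (dy k (dy l (spray L i))) x y := dirDeriv_congr hU (hsym i k l) h _ _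
    have h4 : ∑ m, dy m (spray L i) x y * dy l (dy k (spray L m)) x y
        = ∑ m, dy m (spray L i) x y * dy k (dy l (spray L m)) x y :=
      Finset.sum_congr rfl fun m _ => by rw [hsym m k l x y h]
    linarith
  have hSΓ' : ∀ i k l x y, (x, y) ∈ U →
      geodDeriv L (dy l (dy k (spray L i))) x y = dx k (dy l (spray L i)) x y
        + ∑ m, dy l (spray L m) x y * dy m (dy k (spray L i)) x y
        - ∑ m, dy m (spray L i) x y * dy l (dy k (spray L m)) x y := fun i k l x y h => by
    have h1 := hSΓ i k l x y h
    have h2 := hH i k l x y h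
    linarith
  -- A second vertical derivative yields the spray derivative of `B`, together with the unwanted
  -- terms `∂Γⁱ_{jk}/∂xˡ` and `∂Γⁱ_{kl}/∂xʲ`.
  have h1 := dy_congr hU (hSΓ' i j k) l hx
  rw [dy_geodDeriv hU hG (hΓ i j k) l hx,
    dy_sub hU (f := fun x y => dx j (dy k (spray L i)) x y
        + ∑ m, dy k (spray L m) x y * dy m (dy j (spray L i)) x y)
      ((hXN i k j).add (hNΓ i k j)) (hNΓ' i j k) l hx,
    dy_add hU (hXN i k j) (hNΓ i k j) l hx,
    dy_sum_mul hU Finset.univ (fun m => hN m k) (fun m => hΓ i j m) l hx,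
    dy_sum_mul hU Finset.univ (hN i) (fun m => hΓ m j k) l hx,
    ← dx_dy_comm hU (hN i k) j l hx] at h1
  -- The `yᵏ`-derivative of integrability expresses exactly the difference of those two terms,
  -- without `x`-derivatives.
  have h2 := dy_congr hU (hH i j l) k hx
  rw [dy_sub hU (hXN i j l) (hXN i l j) k hx, dy_sub hU (hNΓ i l j) (hNΓ i j l) k hx,
    dy_sum_mul hU Finset.univ (fun m => hN m l) (fun m => hΓ i j m) k hx,
    dy_sum_mul hU Finset.univ (fun m => hN m j) (fun m => hΓ i l m) k hx,
    ← dx_dy_comm hU (hN i j) l k hx, ← dx_dy_comm hU (hN i l) j k hx,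
    dx_congr hU (hsym i l k) j hx] at h2
  rw [horCov13Zero_eq hU hG hE (T := berwald L) hB i j k l hx]
  simp only [berwald]
  have e1 : ∑ m, dy l (dy k (dy j (spray L m))) x y * dy m (spray L i) x y
      = ∑ m, dy m (spray L i) x y * dy l (dy k (dy j (spray L m))) x y :=
    Finset.sum_congr rfl fun m _ => mul_comm _ _
  have e2 : ∑ m, dy l (dy k (dy m (spray L i))) x y * dy j (spray L m) x y
      = ∑ m, dy j (spray L m) x y * dy k (dy m (dy l (spray L i))) x y :=
    Finset.sum_congr rfl fun m _ => by
      rw [mul_comm, dy_dy_comm hU (hN i m) l k hx, dy_congr hU (hsym i m l) k hx]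
  have e3 : ∑ m, dy l (dy m (dy j (spray L i))) x y * dy k (spray L m) x y
      = ∑ m, dy k (spray L m) x y * dy l (dy m (dy j (spray L i))) x y :=
    Finset.sum_congr rfl fun m _ => mul_comm _ _
  have e4 : ∑ m, dy m (dy k (dy j (spray L i))) x y * dy l (spray L m) x y
      = ∑ m, dy l (spray L m) x y * dy m (dy k (dy j (spray L i))) x y :=
    Finset.sum_congr rfl fun m _ => mul_comm _ _
  have e5 : ∑ m, dy l (spray L m) x y * dy k (dy m (dy j (spray L i))) x y
      = ∑ m, dy l (spray L m) x y * dy m (dy k (dy j (spray L i))) x y :=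
    Finset.sum_congr rfl fun m _ => by rw [dy_dy_comm hU (hN i j) k m hx]
  have e6 : ∑ m, dy k (dy l (spray L m)) x y * dy m (dy j (spray L i)) x y
      = ∑ m, dy l (dy k (spray L m)) x y * dy m (dy j (spray L i)) x y :=
    Finset.sum_congr rfl fun m _ => by rw [hsym m l k x y hx]
  have e7 : ∑ m, dy k (dy j (spray L m)) x y * dy m (dy l (spray L i)) x y
      = ∑ m, dy l (dy m (spray L i)) x y * dy k (dy j (spray L m)) x y :=
    Finset.sum_congr rfl fun m _ => by rw [hsym i m l x y hx, mul_comm]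
  rw [e5, e6, e7] at h2
  rw [e1, e2, e3, e4]
  linarith

end SprayCalculus

/-! ### Consequences of `R = 0` and of a divergence-free spray. -/

section VanishingCurvature

variable {n : ℕ} {U : Set (Coord n × Coord n)} {L : Coord n → Coord n → ℝ}

theorem horDeriv_congr (hU : IsOpen U) {f g : Coord n → Coord n → ℝ}
    (h : ∀ x y, (x, y) ∈ U → f x y = g x y) (m : Fin n) {x y : Coord n} (hx : (x, y) ∈ U) :
    horDeriv L m f x y = horDeriv L m g x y := by
  simp only [horDeriv, dx_congr hU h m hx, fun r => dy_congr hU h r hx]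

theorem horDeriv_eq_zero (hU : IsOpen U) {f : Coord n → Coord n → ℝ}
    (h : ∀ x y, (x, y) ∈ U → f x y = 0) (m : Fin n) {x y : Coord n} (hx : (x, y) ∈ U) :
    horDeriv L m f x y = 0 := by
  simp [horDeriv, dx_eq_zero hU h m hx, fun r => dy_eq_zero hU h r hx]

theorem horCov13Zero_congr (hU : IsOpen U)
    {T T' : Fin n → Fin n → Fin n → Fin n → Coord n → Coord n → ℝ}
    (h : ∀ i j k l x y, (x, y) ∈ U → T i j k l x y = T' i j k l x y)
    (i j k l : Fin n) {x y : Coord n} (hx : (x, y) ∈ U) :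
    horCov13Zero L T i j k l x y = horCov13Zero L T' i j k l x y := by
  simp only [horCov13Zero, horCov13, fun m => horDeriv_congr (L := L) hU (h i j k l) m hx,
    fun i j k l => h i j k l x y hx]

theorem horCov13Zero_eq_zero (hU : IsOpen U)
    {T : Fin n → Fin n → Fin n → Fin n → Coord n → Coord n → ℝ}
    (h : ∀ i j k l x y, (x, y) ∈ U → T i j k l x y = 0)
    (i j k l : Fin n) {x y : Coord n} (hx : (x, y) ∈ U) :
    horCov13Zero L T i j k l x y = 0 := by
  simp [horCov13Zero, horCov13, fun m => horDeriv_eq_zero (L := L) hU (h i j k l) m hx,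
    fun i j k l => h i j k l x y hx]

theorem horCov02_eq_zero (hU : IsOpen U) {T : Fin n → Fin n → Coord n → Coord n → ℝ}
    (h : ∀ j k x y, (x, y) ∈ U → T j k x y = 0)
    (j k m : Fin n) {x y : Coord n} (hx : (x, y) ∈ U) :
    horCov02 L T j k m x y = 0 := by
  simp [horCov02, horDeriv_eq_zero hU (h j k) m hx, fun j k => h j k x y hx]

theorem douglas_eq_berwald (hU : IsOpen U)
    (hdiv : ∀ x y, (x, y) ∈ U → ∑ m, dy m (spray L m) x y = 0)
    (i j k l : Fin n) {x y : Coord n} (hx : (x, y) ∈ U) :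
    douglas L i j k l x y = berwald L i j k l x y := by
  have h1 : ∀ x y, (x, y) ∈ U → (∑ m, dy m (spray L m) x y) * y i = 0 :=
    fun x y h => by rw [hdiv x y h, zero_mul]
  have h2 := dy_eq_zero hU (fun x y h => dy_eq_zero hU (fun x y h => dy_eq_zero hU h1 j h) k h) l hx
  rw [douglas, h2]
  ring

/-- After commuting vertical derivatives, `2 E_{jk}` is the vertical Hessian of the divergence
`∂Gᵐ/∂yᵐ`. -/
theorem meanBerwald_eq_zero (hU : IsOpen U) (hG : ∀ i, ContDiffOn ℝ ∞ (joint (spray L i)) U)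
    (hdiv : ∀ x y, (x, y) ∈ U → ∑ m, dy m (spray L m) x y = 0)
    (j k : Fin n) {x y : Coord n} (hx : (x, y) ∈ U) :
    meanBerwald L j k x y = 0 := by
  have hN := fun i j => contDiffOn_dy hU (hG i) j
  have h1 : ∀ x y, (x, y) ∈ U → ∑ m, dy j (dy m (spray L m)) x y = 0 := fun x y h => by
    rw [← dy_sum hU Finset.univ (fun m => hN m m) j h]
    exact dy_eq_zero hU hdiv j h
  have h2 : ∑ m, dy k (dy j (dy m (spray L m))) x y = 0 := by
    rw [← dy_sum hU Finset.univ (fun m => contDiffOn_dy hU (hN m m) j) k hx]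
    exact dy_eq_zero hU h1 k hx
  have h3 : ∀ m, berwald L m j k m x y = dy k (dy j (dy m (spray L m))) x y := fun m => by
    rw [berwald, dy_dy_comm hU (hN m j) m k hx,
      dy_congr hU (fun x y h => dy_dy_comm hU (hG m) m j h) k hx]
  rw [meanBerwald, Finset.sum_congr rfl fun m _ => h3 m, h2, mul_zero]

theorem theta_eq_zero (hU : IsOpen U) (hG : ∀ i, ContDiffOn ℝ ∞ (joint (spray L i)) U)
    (hdiv : ∀ x y, (x, y) ∈ U → ∑ m, dy m (spray L m) x y = 0)
    (hR : ∀ i k x y, (x, y) ∈ U → riemann L i k x y = 0)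
    (j k l : Fin n) {x y : Coord n} (hx : (x, y) ∈ U) :
    theta L j k l x y = 0 := by
  have h1 := horCov02_eq_zero (L := L) hU
    (fun j k x y h => meanBerwald_eq_zero hU hG hdiv j k h) j k l hx
  have hr : ∀ x y, (x, y) ∈ U → ricciScalar L x y = 0 := fun x y h => by
    simp [ricciScalar, fun i k => hR i k x y h]
  have h2 : ∀ x y, (x, y) ∈ U →
      (∑ s, dy s (riemann L s l) x y) - ((n : ℝ) + 2) * dy l (ricciScalar L) x y = 0 :=
    fun x y h => by simp [fun s => dy_eq_zero hU (hR s l) s h, dy_eq_zero hU hr l h]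
  have h3 := dy_eq_zero hU (fun x y h => dy_eq_zero hU h2 j h) k hx
  rw [theta, h1, h3]
  ring

theorem flagCurvature_eq_zero {x y : Coord n} (hR : ∀ i k, riemann L i k x y = 0) (u : Coord n) :
    flagCurvature L x y u = 0 := by
  simp [flagCurvature, hR]

/-- Zero divergence replaces the Douglas tensor by the Berwald curvature, and flatness makes the
latter parallel along the spray. -/
theorem dTilde_eq_zero (hU : IsOpen U) (hG : ∀ i, ContDiffOn ℝ ∞ (joint (spray L i)) U)
    (hE : ∀ i x y, (x, y) ∈ U → ∑ m, y m * dy m (spray L i) x y = 2 * spray L i x y)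
    (hdiv : ∀ x y, (x, y) ∈ U → ∑ m, dy m (spray L m) x y = 0)
    (hR : ∀ i k x y, (x, y) ∈ U → riemann L i k x y = 0)
    (i j k l : Fin n) {x y : Coord n} (hx : (x, y) ∈ U) :
    dTilde L i j k l x y = 0 := by
  rw [dTilde, horCov13Zero_congr hU (fun i j k l x y h => douglas_eq_berwald hU hdiv i j k l h)
    i j k l hx]
  exact horCov13Zero_berwald_eq_zero hU hG hE hR i j k l hx

end VanishingCurvature

/-! ### Douglas metrics are generalized `D̃`-metrics. -/

section Slit

variable {n : ℕ} {M : Type*} [TopologicalSpace M]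

theorem isOpen_target_prod_slit (e : OpenPartialHomeomorph M (Coord n)) :
    IsOpen (e.target ×ˢ {y : Coord n | y ≠ 0}) :=
  e.open_target.prod isOpen_ne

variable [ChartedSpace (Coord n) M]

theorem DouglasVanishes.dTildeVanishes {F : TangentBundle (𝓡 n) M → ℝ}
    (hD : DouglasVanishes F) : DTildeVanishes F := fun e he _ hx _ hy i j k l =>
  horCov13Zero_eq_zero (isOpen_target_prod_slit e)
    (fun i j k l _ _ h => hD e he _ h.1 _ h.2 i j k l) i j k l ⟨hx, hy⟩

variable [IsManifold (𝓡 n) ∞ M]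

/-- `μ = 0` works: `D̃` vanishes on an open set, so its covariant derivative does too. -/
theorem IsFinslerMetric.isGeneralizedDTildeMetric {F : TangentBundle (𝓡 n) M → ℝ}
    (hF : IsFinslerMetric F) (hD : DTildeVanishes F) : IsGeneralizedDTildeMetric F := by
  refine ⟨hF, fun _ => 0, fun e _ r => contDiffOn_const, fun e he x hx y hy i j k l => ?_⟩
  have h := horCov13Zero_eq_zero (L := localRep F e) (isOpen_target_prod_slit e)
    (T := dTilde (localRep F e)) (fun i j k l x y h => hD e he x h.1 y h.2 i j k l)
    i j k l (x := x) (y := y) ⟨hx, hy⟩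
  have h0 := fun r => hD e he x hx y hy r j k l
  simp [h, h0]

theorem IsDouglasMetric.isGeneralizedDTildeMetric {F : TangentBundle (𝓡 n) M → ℝ}
    (hF : IsDouglasMetric F) : IsGeneralizedDTildeMetric F :=
  hF.1.isGeneralizedDTildeMetric hF.2.dTildeVanishes

end Slit

/-! ### The navigation equation and first derivatives of `F`, `V`, `D`, `p`. -/

section Navigation

/-- The skew endomorphism of `ℝ³` generating the rotations about the third axis. -/
def rot (z : Fin 3 → ℝ) : Fin 3 → ℝ := ![z 1, -z 0, 0]

/-- `1 - |W|²` for the rotational vector field `W = rot x`. -/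
def windDefect (x : Coord 3) : ℝ := 1 - x 0 ^ 2 - x 1 ^ 2

/-- The square root in the Randers metric on the ball. -/
def navRoot (x y : Coord 3) : ℝ :=
  Real.sqrt ((-(x 1) * y 0 + x 0 * y 1) ^ 2
    + (y 0 ^ 2 + y 1 ^ 2 + y 2 ^ 2) * (1 - x 0 ^ 2 - x 1 ^ 2))

/-- The Randers metric on the ball in Cartesian coordinates. -/
def navF (x y : Coord 3) : ℝ :=
  navRoot x y / (1 - x 0 ^ 2 - x 1 ^ 2)
    + (-(x 1) * y 0 + x 0 * y 1) / (1 - x 0 ^ 2 - x 1 ^ 2)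

/-- The Euclidean velocity `y - F W` relative to the wind. -/
def navV (i : Fin 3) (x y : Coord 3) : ℝ := y i - navF x y * rot x i

/-- The momentum `∂F/∂yⁱ`. -/
def navP (i : Fin 3) (x y : Coord 3) : ℝ := navV i x y / navRoot x y

/-- The slit tangent bundle of the unit ball. -/
def ballSlit : Set (Coord 3 × Coord 3) := Metric.ball 0 1 ×ˢ {y | y ≠ 0}

theorem isOpen_ballSlit : IsOpen ballSlit := Metric.isOpen_ball.prod isOpen_ne

variable {x y : Coord 3}

theorem windDefect_pos (hx : x ∈ Metric.ball (0 : Coord 3) 1) : 0 < windDefect x := by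
  have h : ‖x‖ < 1 := by simpa using hx
  have h2 : ‖x‖ ^ 2 < 1 := by nlinarith [norm_nonneg x]
  rw [EuclideanSpace.real_norm_sq_eq, Fin.sum_univ_three] at h2
  rw [windDefect]
  nlinarith [sq_nonneg (x 2)]

theorem sq_sum_pos (hy : y ≠ 0) : 0 < y 0 ^ 2 + y 1 ^ 2 + y 2 ^ 2 := by
  have h : 0 < ‖y‖ ^ 2 := by positivity
  rwa [EuclideanSpace.real_norm_sq_eq, Fin.sum_univ_three] at h

theorem navRadicand_pos (h : (x, y) ∈ ballSlit) :
    0 < (-(x 1) * y 0 + x 0 * y 1) ^ 2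
      + (y 0 ^ 2 + y 1 ^ 2 + y 2 ^ 2) * (1 - x 0 ^ 2 - x 1 ^ 2) := by
  have h1 := mul_pos (sq_sum_pos h.2) (windDefect_pos h.1)
  rw [windDefect] at h1
  nlinarith [sq_nonneg (-(x 1) * y 0 + x 0 * y 1)]

theorem navRoot_pos (h : (x, y) ∈ ballSlit) : 0 < navRoot x y :=
  Real.sqrt_pos.2 (navRadicand_pos h)

theorem navRoot_sq (h : (x, y) ∈ ballSlit) :
    navRoot x y ^ 2 = (-(x 1) * y 0 + x 0 * y 1) ^ 2
      + (y 0 ^ 2 + y 1 ^ 2 + y 2 ^ 2) * (1 - x 0 ^ 2 - x 1 ^ 2) :=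
  Real.sq_sqrt (navRadicand_pos h).le

theorem windDefect_mul_navF (hx : x ∈ Metric.ball (0 : Coord 3) 1) :
    (1 - x 0 ^ 2 - x 1 ^ 2) * navF x y = navRoot x y - (x 1 * y 0 - x 0 * y 1) := by
  have h := (windDefect_pos hx).ne'
  rw [windDefect] at h
  rw [navF]
  field_simp
  ring

theorem navF_pos (h : (x, y) ∈ ballSlit) : 0 < navF x y := by
  have h1 := windDefect_pos h.1
  have h2 := windDefect_mul_navF (y := y) h.1
  have h3 : x 1 * y 0 - x 0 * y 1 < navRoot x y := by
    refine Real.lt_sqrt_of_sq_lt ?_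
    have h4 := mul_pos (sq_sum_pos h.2) h1
    rw [windDefect] at h4
    nlinarith
  rw [windDefect] at h1
  by_contra hc
  nlinarith [mul_nonneg h1.le (neg_nonneg.2 (not_lt.1 hc))]

/-- The parenthesis is `⟨V, W⟩`; substituting `V = y - F W` turns this into the formula for the
positive root of the navigation quadratic. -/
theorem navRoot_eq (hx : x ∈ Metric.ball (0 : Coord 3) 1) :
    navRoot x y = navF x y + (navV 0 x y * x 1 - navV 1 x y * x 0) := by
  have h := windDefect_mul_navF (y := y) hx
  simp [navV, rot]
  linarith

/-- The navigation equation `|y - F W|² = F²`. Written out, it is `(1 - |W|²) F² + 2⟨W, y⟩ F - |y|²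
= 0`, whose discriminant is under the root `D`. Derivatives of `F` come from this equation, not from
the radical formula. -/
theorem sum_navV_sq (h : (x, y) ∈ ballSlit) :
    navV 0 x y ^ 2 + navV 1 x y ^ 2 + navV 2 x y ^ 2 = navF x y ^ 2 := by
  have h1 := windDefect_mul_navF (y := y) h.1
  have h2 := navRoot_sq h
  have h3 : navRoot x y = (1 - x 0 ^ 2 - x 1 ^ 2) * navF x y + (x 1 * y 0 - x 0 * y 1) := by
    linarith
  rw [h3] at h2
  have h4 := (windDefect_pos h.1).ne'
  rw [windDefect] at h4
  simp [navV, rot]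
  apply mul_left_cancel₀ h4
  linear_combination -h2

theorem navV_eq (h : (x, y) ∈ ballSlit) (i : Fin 3) :
    navV i x y = navRoot x y * navP i x y := by
  rw [navP, mul_div_cancel₀ _ (navRoot_pos h).ne']

theorem navF_eq_mul (h : (x, y) ∈ ballSlit) :
    navF x y = navRoot x y * (1 - (navP 0 x y * x 1 - navP 1 x y * x 0)) := by
  have := navRoot_eq (y := y) h.1
  rw [navV_eq h, navV_eq h] at this
  linarith

/-- The navigation equation divided by `D²`: the dual relation `|p|² = (1 - ⟨p, W⟩)²` between
momentum and wind. -/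
theorem sum_navP_sq (h : (x, y) ∈ ballSlit) :
    navP 0 x y ^ 2 + navP 1 x y ^ 2 + navP 2 x y ^ 2
      = (1 - (navP 0 x y * x 1 - navP 1 x y * x 0)) ^ 2 := by
  have h1 := sum_navV_sq h
  rw [navV_eq h, navV_eq h, navV_eq h, navF_eq_mul h] at h1
  apply mul_left_cancel₀ (pow_ne_zero 2 (navRoot_pos h).ne')
  linear_combination h1

theorem contDiffOn_navRoot : ContDiffOn ℝ ∞ (joint navRoot) ballSlit := by
  refine ContDiffOn.sqrt (by fun_prop) fun q hq => (navRadicand_pos (x := q.1) (y := q.2) hq).ne'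

theorem contDiffOn_navF : ContDiffOn ℝ ∞ (joint navF) ballSlit := by
  have h : ∀ q ∈ ballSlit, (1 - q.1 0 ^ 2 - q.1 1 ^ 2) ≠ 0 := fun q hq => (windDefect_pos hq.1).ne'
  exact (contDiffOn_navRoot.div (by fun_prop) h).add
    (ContDiffOn.div (by fun_prop) (by fun_prop) h)

theorem contDiff_rot (i : Fin 3) : ContDiff ℝ ∞ (joint fun x _ => rot x i) := by
  fin_cases i <;> simp [rot] <;> fun_prop

theorem contDiffOn_navV (i : Fin 3) : ContDiffOn ℝ ∞ (joint (navV i)) ballSlit :=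
  (contDiff_joint_snd i).contDiffOn.sub (contDiffOn_navF.mul (contDiff_rot i).contDiffOn)

theorem contDiffOn_navP (i : Fin 3) : ContDiffOn ℝ ∞ (joint (navP i)) ballSlit :=
  (contDiffOn_navV i).div contDiffOn_navRoot fun q hq => (navRoot_pos (x := q.1) (y := q.2) hq).ne'

theorem hasDerivAt_line (x a : Coord 3) (i : Fin 3) :
    HasDerivAt (fun t : ℝ => (x + t • a) i) (a i) 0 := by
  simpa using ((hasDerivAt_id (0 : ℝ)).mul_const (a i)).const_add (x i)

theorem hasDerivAt_rot_line (x a : Coord 3) (i : Fin 3) :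
    HasDerivAt (fun t : ℝ => rot (x + t • a).ofLp i) (rot a i) 0 := by
  fin_cases i
  · exact hasDerivAt_line x a 1
  · exact (hasDerivAt_line x a 0).neg
  · exact hasDerivAt_const _ _

theorem hasDerivAt_navV (h : (x, y) ∈ ballSlit) (a b : Coord 3) (i : Fin 3) :
    HasDerivAt (fun t : ℝ => navV i (x + t • a) (y + t • b))
      (b i - (dirDeriv navF x y a b * rot x i + navF x y * rot a i)) 0 := by
  have hF := hasDerivAt_dirDeriv (differentiableAt_joint isOpen_ballSlit contDiffOn_navF h) a b
  simpa [navV] using (hasDerivAt_line y b i).fun_sub (hF.fun_mul (hasDerivAt_rot_line x a i))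

/-- Implicit differentiation of `|V|² = F²`. The coefficient of the derivative of `F` is `F + ⟨V, W⟩
= D`, so dividing by `D` brings in `p = V / D`. -/
theorem dirDeriv_navF (h : (x, y) ∈ ballSlit) (a b : Coord 3) :
    dirDeriv navF x y a b = navP 0 x y * b 0 + navP 1 x y * b 1 + navP 2 x y * b 2
      + navF x y * (navP 1 x y * a 0 - navP 0 x y * a 1) := by
  have hF := hasDerivAt_dirDeriv (differentiableAt_joint isOpen_ballSlit contDiffOn_navF h) a b
  have hV := hasDerivAt_navV h a b
  have h1 := (((hV 0).fun_pow 2).fun_add ((hV 1).fun_pow 2)).fun_add ((hV 2).fun_pow 2)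
  have h2 : (fun t : ℝ => navF (x + t • a) (y + t • b) ^ 2) =ᶠ[nhds 0] fun t : ℝ =>
      navV 0 (x + t • a) (y + t • b) ^ 2 + navV 1 (x + t • a) (y + t • b) ^ 2
        + navV 2 (x + t • a) (y + t • b) ^ 2 := by
    have hc : ContinuousAt (fun t : ℝ => (x + t • a, y + t • b)) 0 := by fun_prop
    have : ballSlit ∈ nhds (x + (0 : ℝ) • a, y + (0 : ℝ) • b) :=
      isOpen_ballSlit.mem_nhds (by simpa using h)
    exact (hc.eventually this).mono fun t ht => (sum_navV_sq ht).symm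
  have h3 := (h1.congr_of_eventuallyEq h2).unique (hF.fun_pow 2)
  simp [rot] at h3
  have hD := navRoot_eq (y := y) h.1
  apply mul_left_cancel₀ (navRoot_pos h).ne'
  rw [navV_eq h, navV_eq h, navV_eq h] at h3
  rw [navV_eq h, navV_eq h] at hD
  linear_combination (dirDeriv navF x y a b) * hD - h3 / 2

theorem dirDeriv_navV (h : (x, y) ∈ ballSlit) (a b : Coord 3) (i : Fin 3) :
    dirDeriv (navV i) x y a b = b i - (dirDeriv navF x y a b * rot x i + navF x y * rot a i) :=
  (hasDerivAt_dirDeriv (differentiableAt_joint isOpen_ballSlit (contDiffOn_navV i) h) a b).unique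
    (hasDerivAt_navV h a b i)

theorem dirDeriv_navRoot (h : (x, y) ∈ ballSlit) (a b : Coord 3) :
    dirDeriv navRoot x y a b = dirDeriv navF x y a b
      + (dirDeriv (navV 0) x y a b * x 1 + navV 0 x y * a 1
        - (dirDeriv (navV 1) x y a b * x 0 + navV 1 x y * a 0)) := by
  have hd := fun {f} hf => differentiableAt_joint (f := f) isOpen_ballSlit hf h
  have hF := hasDerivAt_dirDeriv (hd contDiffOn_navF) a b
  have hV := fun i => hasDerivAt_dirDeriv (hd (contDiffOn_navV i)) a b
  refine (hasDerivAt_dirDeriv (hd contDiffOn_navRoot) a b).unique ?_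
  have h1 := hF.fun_add (((hV 0).fun_mul (hasDerivAt_line x a 1)).fun_sub
    ((hV 1).fun_mul (hasDerivAt_line x a 0)))
  simp only [zero_smul, add_zero] at h1
  refine h1.congr_of_eventuallyEq ?_
  have hc : ContinuousAt (fun t : ℝ => x + t • a) 0 := by fun_prop
  have : Metric.ball 0 1 ∈ nhds (x + (0 : ℝ) • a) :=
    Metric.isOpen_ball.mem_nhds (by simpa using h.1)
  exact (hc.eventually this).mono fun t ht => navRoot_eq ht

theorem dirDeriv_navP (h : (x, y) ∈ ballSlit) (a b : Coord 3) (i : Fin 3) :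
    navRoot x y * dirDeriv (navP i) x y a b
      = dirDeriv (navV i) x y a b - dirDeriv navRoot x y a b * navP i x y := by
  have hd := fun {f} hf => differentiableAt_joint (f := f) isOpen_ballSlit hf h
  have h1 := dirDeriv_mul (hd contDiffOn_navRoot) (hd (contDiffOn_navP i)) a b
  rw [← dirDeriv_congr isOpen_ballSlit (fun x y h => navV_eq h i) h] at h1
  linarith

end Navigation

/-! ### The fundamental tensor, its determinant, and the spray. -/

section FundamentalTensor

variable {x y : Coord 3}

theorem lineDeriv_eq_dirDeriv {n : ℕ} {f : Coord n → Coord n → ℝ} {x y : Coord n}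
    (hf : DifferentiableAt ℝ (joint f) (x, y)) (u : Coord n) :
    lineDeriv ℝ (f x) y u = dirDeriv f x y 0 u := by
  have h := (hasDerivAt_dirDeriv hf 0 u).deriv
  simpa [lineDeriv] using h

/-- The ratio `F / (F + ⟨v, W⟩) = 1 - ⟨p, W⟩`. -/
def navRatio (x y : Coord 3) : ℝ := 1 - (navP 0 x y * x 1 - navP 1 x y * x 0)

theorem navF_eq (h : (x, y) ∈ ballSlit) : navF x y = navRoot x y * navRatio x y :=
  navF_eq_mul h

theorem navRatio_pos (h : (x, y) ∈ ballSlit) : 0 < navRatio x y := by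
  have h1 := navF_pos h
  rw [navF_eq h] at h1
  exact pos_of_mul_pos_right h1 (navRoot_pos h).le

theorem sum_navP_sq_eq (h : (x, y) ∈ ballSlit) :
    navP 0 x y ^ 2 + navP 1 x y ^ 2 + navP 2 x y ^ 2 = navRatio x y ^ 2 :=
  sum_navP_sq h

theorem dirDeriv_navF_sq (h : (x, y) ∈ ballSlit) (a b : Coord 3) :
    dirDeriv (fun x y => navF x y ^ 2) x y a b = 2 * navF x y * dirDeriv navF x y a b := by
  have hd := differentiableAt_joint isOpen_ballSlit contDiffOn_navF h
  simp only [pow_two]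
  rw [dirDeriv_mul hd hd]
  ring

theorem contDiffOn_navF_sq : ContDiffOn ℝ ∞ (joint fun x y => navF x y ^ 2) ballSlit :=
  contDiffOn_navF.pow 2

/-- The differential `∂F²/∂yⁱ` applied to a vector. -/
def navMom (w x y : Coord 3) : ℝ :=
  2 * navF x y * (navP 0 x y * w 0 + navP 1 x y * w 1 + navP 2 x y * w 2)

theorem contDiffOn_navMom (w : Coord 3) : ContDiffOn ℝ ∞ (joint (navMom w)) ballSlit :=
  (contDiffOn_const.mul contDiffOn_navF).mul
    ((((contDiffOn_navP 0).mul contDiffOn_const).add ((contDiffOn_navP 1).mul contDiffOn_const)).add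
      ((contDiffOn_navP 2).mul contDiffOn_const))

theorem dirDeriv_navMom (h : (x, y) ∈ ballSlit) (w a b : Coord 3) :
    dirDeriv (navMom w) x y a b
      = 2 * dirDeriv navF x y a b * (navP 0 x y * w 0 + navP 1 x y * w 1 + navP 2 x y * w 2)
        + 2 * navRatio x y * (navRoot x y * dirDeriv (navP 0) x y a b * w 0
          + navRoot x y * dirDeriv (navP 1) x y a b * w 1
          + navRoot x y * dirDeriv (navP 2) x y a b * w 2) := by
  have hd := fun {f} hf => differentiableAt_joint (f := f) isOpen_ballSlit hf h
  have hF := hasDerivAt_dirDeriv (hd contDiffOn_navF) a b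
  have hP := fun i => hasDerivAt_dirDeriv (hd (contDiffOn_navP i)) a b
  have h1 := (hF.const_mul 2).fun_mul ((((hP 0).mul_const (w 0)).fun_add
    ((hP 1).mul_const (w 1))).fun_add ((hP 2).mul_const (w 2)))
  rw [(hasDerivAt_dirDeriv (hd (contDiffOn_navMom w)) a b).unique h1]
  simp only [zero_smul, add_zero]
  rw [navF_eq h]
  ring

theorem lineDeriv_navF_sq (h : (x, y) ∈ ballSlit) (w : Coord 3) :
    lineDeriv ℝ (fun y' => navF x y' ^ 2) y w = navMom w x y := by
  have := lineDeriv_eq_dirDeriv (differentiableAt_joint isOpen_ballSlit contDiffOn_navF_sq h) w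
  rw [this, dirDeriv_navF_sq h, dirDeriv_navF h, navMom]
  simp

theorem fundForm_navF_eq (h : (x, y) ∈ ballSlit) (u w : Coord 3) :
    fundForm (navF x) y u w = (1 / 2) * dirDeriv (navMom w) x y 0 u := by
  rw [fundForm, ← lineDeriv_eq_dirDeriv
    (differentiableAt_joint isOpen_ballSlit (contDiffOn_navMom w) h) u]
  congr 1
  refine Filter.EventuallyEq.lineDeriv_eq ?_
  filter_upwards [isOpen_ne.mem_nhds h.2] with y' hy'
  exact lineDeriv_navF_sq (x := x) (y := y') ⟨h.1, hy'⟩ w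

theorem fundForm_navF (h : (x, y) ∈ ballSlit) (u w : Coord 3) :
    fundForm (navF x) y u w =
      (navP 0 x y * u 0 + navP 1 x y * u 1 + navP 2 x y * u 2)
        * (navP 0 x y * w 0 + navP 1 x y * w 1 + navP 2 x y * w 2)
      + navRatio x y * (u 0 * w 0 + u 1 * w 1 + u 2 * w 2
        - (navP 0 x y * u 0 + navP 1 x y * u 1 + navP 2 x y * u 2) * (x 1 * w 0 - x 0 * w 1)
        - (navP 0 x y * w 0 + navP 1 x y * w 1 + navP 2 x y * w 2) * (x 1 * u 0 - x 0 * u 1)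
        - (1 - x 0 ^ 2 - x 1 ^ 2)
          * (navP 0 x y * u 0 + navP 1 x y * u 1 + navP 2 x y * u 2)
          * (navP 0 x y * w 0 + navP 1 x y * w 1 + navP 2 x y * w 2)) := by
  rw [fundForm_navF_eq h, dirDeriv_navMom h, dirDeriv_navP h, dirDeriv_navP h, dirDeriv_navP h,
    dirDeriv_navRoot h, dirDeriv_navV h, dirDeriv_navV h, dirDeriv_navV h, dirDeriv_navF h]
  simp [rot]
  ring

/-- Put `c = ⟨p, u⟩`, `q = u - c W` and `s = F/D`. Then `g(u, u) = c² + s(|q|² - c²)`. Since `⟨p, q⟩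
= s c` and `|p| = s > 0`, the Cauchy-Schwarz inequality gives `c² ≤ |q|²`. In the degenerate case `c
= 0`, and then `q = u ≠ 0`. -/
theorem fundForm_navF_pos (h : (x, y) ∈ ballSlit) {u : Coord 3} (hu : u ≠ 0) :
    0 < fundForm (navF x) y u u := by
  rw [fundForm_navF h]
  have hs := navRatio_pos h
  have hp := sum_navP_sq_eq h
  have hs' : navRatio x y = 1 - (navP 0 x y * x 1 - navP 1 x y * x 0) := rfl
  generalize navRatio x y = s at *
  generalize navP 0 x y = p0 at *
  generalize navP 1 x y = p1 at *
  generalize navP 2 x y = p2 at *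
  generalize hc : p0 * u 0 + p1 * u 1 + p2 * u 2 = c
  generalize hq0 : u 0 - c * x 1 = q0
  generalize hq1 : u 1 + c * x 0 = q1
  have hpq : p0 * q0 + p1 * q1 + p2 * u 2 = s * c := by
    rw [hs']; linear_combination hc - p0 * hq0 - p1 * hq1
  have hcs : (s * c) ^ 2 ≤ s ^ 2 * (q0 ^ 2 + q1 ^ 2 + u 2 ^ 2) := by
    rw [← hpq, ← hp]
    nlinarith [sq_nonneg (p0 * q1 - p1 * q0), sq_nonneg (p0 * u 2 - p2 * q0),
      sq_nonneg (p1 * u 2 - p2 * q1)]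
  have hcs' : c ^ 2 ≤ q0 ^ 2 + q1 ^ 2 + u 2 ^ 2 := by
    rw [mul_pow] at hcs
    exact le_of_mul_le_mul_left hcs (by positivity)
  have hval : c * c + s * (u 0 * u 0 + u 1 * u 1 + u 2 * u 2 - c * (x 1 * u 0 - x 0 * u 1)
        - c * (x 1 * u 0 - x 0 * u 1) - (1 - x 0 ^ 2 - x 1 ^ 2) * c * c)
      = c ^ 2 + s * (q0 ^ 2 + q1 ^ 2 + u 2 ^ 2 - c ^ 2) := by
    rw [← hq0, ← hq1]; ring
  rw [hval]
  have h1 : 0 ≤ s * (q0 ^ 2 + q1 ^ 2 + u 2 ^ 2 - c ^ 2) := mul_nonneg hs.le (by linarith)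
  by_contra hcon
  have hc0 : c = 0 := by nlinarith [sq_nonneg c]
  subst hc0
  have h2 : q0 ^ 2 + q1 ^ 2 + u 2 ^ 2 ≤ 0 := by
    by_contra h3
    have := mul_pos hs (not_le.1 h3)
    apply hcon
    simpa using this
  have h3 := sq_sum_pos hu
  simp only [zero_mul, sub_zero, add_zero] at hq0 hq1
  rw [hq0, hq1] at h3
  linarith

theorem gMat_navF_apply (i j : Fin 3) :
    gMat navF x y i j = fundForm (navF x) y (coordVec i) (coordVec j) := rfl

theorem det_gMat_navF (h : (x, y) ∈ ballSlit) : (gMat navF x y).det = navRatio x y ^ 4 := by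
  have hp := sum_navP_sq_eq h
  have hs' : navRatio x y = 1 - (navP 0 x y * x 1 - navP 1 x y * x 0) := rfl
  rw [Matrix.det_fin_three]
  simp only [gMat_navF_apply, fundForm_navF h]
  simp [coordVec]
  generalize navRatio x y = s at *
  generalize navP 0 x y = p0 at *
  generalize navP 1 x y = p1 at *
  generalize navP 2 x y = p2 at *
  subst hs'
  -- The determinant differs from `s⁴` by `s² ⟨p, W⟩ (|p|² - s²)`.
  linear_combination ((1 - (p0 * x 1 - p1 * x 0)) ^ 2 * (p0 * x 1 - p1 * x 0)) * hp

/-- The spray coefficients of the metric on the ball. -/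
def navSpray (i : Fin 3) (x y : Coord 3) : ℝ :=
  -(navF x y * rot y i) + (1 / 2) * navF x y ^ 2 * rot (rot x) i

theorem snd_eq (h : (x, y) ∈ ballSlit) (i : Fin 3) :
    y i = navRoot x y * navP i x y + navF x y * rot x i := by
  rw [← navV_eq h, navV]
  ring

variable {b : Coord 3}

/-- Conservation of `F`. Here and in the next lemmas `b = -2G` is the vertical part of the candidate
spray. In the frame turning with the wind the motion is uniform and straight, so scalars are
constant and the vectors `V`, `p` only rotate. -/
theorem dirDeriv_navF_spray (h : (x, y) ∈ ballSlit) (hb : ∀ i, b i = -2 * navSpray i x y) :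
    dirDeriv navF x y y b = 0 := by
  have h0 := snd_eq h 0
  have h1 := snd_eq h 1
  rw [dirDeriv_navF h, hb, hb, hb]
  simp [navSpray, rot] at h0 h1 ⊢
  linear_combination navF x y * navP 0 x y * h1 - navF x y * navP 1 x y * h0

theorem rot_smul_navP (h : (x, y) ∈ ballSlit) (i : Fin 3) :
    rot (fun j => navV j x y) i = navRoot x y * rot (fun j => navP j x y) i := by
  fin_cases i <;> simp [rot, navV_eq h]

theorem dirDeriv_navV_spray (h : (x, y) ∈ ballSlit) (hb : ∀ i, b i = -2 * navSpray i x y)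
    (i : Fin 3) : dirDeriv (navV i) x y y b = navF x y * rot (fun j => navV j x y) i := by
  rw [dirDeriv_navV h, dirDeriv_navF_spray h hb, hb, navSpray]
  fin_cases i <;> simp [rot, navV] <;> ring

theorem dirDeriv_navRoot_spray (h : (x, y) ∈ ballSlit) (hb : ∀ i, b i = -2 * navSpray i x y) :
    dirDeriv navRoot x y y b = 0 := by
  rw [dirDeriv_navRoot h, dirDeriv_navV_spray h hb, dirDeriv_navV_spray h hb,
    dirDeriv_navF_spray h hb]
  simp [rot, navV]
  ring

theorem dirDeriv_navP_spray (h : (x, y) ∈ ballSlit) (hb : ∀ i, b i = -2 * navSpray i x y)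
    (i : Fin 3) : dirDeriv (navP i) x y y b = navF x y * rot (fun j => navP j x y) i := by
  apply mul_left_cancel₀ (navRoot_pos h).ne'
  rw [dirDeriv_navP h, dirDeriv_navV_spray h hb, dirDeriv_navRoot_spray h hb, rot_smul_navP h]
  ring

theorem sum_mul_coordVec (p : Fin 3 → ℝ) (i : Fin 3) :
    p 0 * (coordVec i : Coord 3) 0 + p 1 * (coordVec i : Coord 3) 1
      + p 2 * (coordVec i : Coord 3) 2 = p i := by
  fin_cases i <;> simp [coordVec]

theorem rot_eq_coordVec (p : Fin 3 → ℝ) (i : Fin 3) :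
    p 1 * (coordVec i : Coord 3) 0 - p 0 * (coordVec i : Coord 3) 1 = rot p i := by
  fin_cases i <;> simp [coordVec, rot]

theorem dy_navF_sq (h : (x, y) ∈ ballSlit) (l : Fin 3) :
    dy l (fun x y => navF x y ^ 2) x y = navMom (coordVec l) x y :=
  lineDeriv_navF_sq h _

theorem dx_navF (h : (x, y) ∈ ballSlit) (l : Fin 3) :
    dx l navF x y = navF x y * rot (fun j => navP j x y) l := by
  rw [dx_eq_dirDeriv (differentiableAt_joint isOpen_ballSlit contDiffOn_navF h),
    dirDeriv_navF h, ← rot_eq_coordVec]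
  simp

theorem dy_navF (h : (x, y) ∈ ballSlit) (l : Fin 3) : dy l navF x y = navP l x y := by
  rw [dy_eq_dirDeriv (differentiableAt_joint isOpen_ballSlit contDiffOn_navF h),
    dirDeriv_navF h, ← sum_mul_coordVec (fun j => navP j x y) l]
  simp

theorem dx_navF_sq (h : (x, y) ∈ ballSlit) (l : Fin 3) :
    dx l (fun x y => navF x y ^ 2) x y = 2 * navF x y ^ 2 * rot (fun j => navP j x y) l := by
  rw [dx_eq_dirDeriv (differentiableAt_joint isOpen_ballSlit contDiffOn_navF_sq h),
    dirDeriv_navF_sq h, ← dx_eq_dirDeriv (differentiableAt_joint isOpen_ballSlit contDiffOn_navF h),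
    dx_navF h]
  ring

theorem gMat_navF_symm (h : (x, y) ∈ ballSlit) (i j : Fin 3) :
    gMat navF x y i j = gMat navF x y j i := by
  rw [gMat_navF_apply, gMat_navF_apply, fundForm_navF h, fundForm_navF h]
  ring

/-- The Euler-Lagrange equation for the candidate spray. As `∂F²/∂y = 2 F p` with `F` conserved and
`p` rotating at rate `F`, its derivative along the candidate is `2 F² rot p = ∂F²/∂x`; the vertical
part of that derivative contributes `-4 g_{lm} Gᵐ`. -/
theorem gMat_mulVec_navSpray (h : (x, y) ∈ ballSlit) (l : Fin 3) :
    (∑ k, dx k (dy l (fun x y => navF x y ^ 2)) x y * y k) - dx l (fun x y => navF x y ^ 2) x y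
      = 4 * ∑ m, gMat navF x y l m * navSpray m x y := by
  have hM := differentiableAt_joint isOpen_ballSlit (contDiffOn_navMom (coordVec l)) h
  have hb : ∀ i, (WithLp.toLp 2 fun i => -2 * navSpray i x y : Coord 3) i = -2 * navSpray i x y :=
    fun i => rfl
  have h1 := dirDeriv_eq_sum hM y (WithLp.toLp 2 fun i => -2 * navSpray i x y)
  have hg : ∀ m, dy m (navMom (coordVec l)) x y = 2 * gMat navF x y l m := fun m => by
    rw [gMat_navF_symm h, gMat_navF_apply, fundForm_navF_eq h, dy_eq_dirDeriv hM]
    ring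
  simp only [hg] at h1
  have h2 : dirDeriv (navMom (coordVec l)) x y y (WithLp.toLp 2 fun i => -2 * navSpray i x y)
      = 2 * navF x y ^ 2 * rot (fun j => navP j x y) l := by
    rw [dirDeriv_navMom h, dirDeriv_navF_spray h hb, dirDeriv_navP_spray h hb,
      dirDeriv_navP_spray h hb, dirDeriv_navP_spray h hb, ← sum_mul_coordVec (rot _) l, navF_eq h]
    ring
  rw [dx_navF_sq h, ← h2, h1]
  simp only [fun k => dx_congr isOpen_ballSlit (fun x y h => dy_navF_sq h l) k h,
    mul_comm (y _), Finset.mul_sum]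
  rw [sub_add_eq_sub_sub, sub_self, zero_sub, ← Finset.sum_neg_distrib]
  exact Finset.sum_congr rfl fun m _ => by ring

theorem spray_navF (h : (x, y) ∈ ballSlit) (i : Fin 3) : spray navF i x y = navSpray i x y := by
  have hdet : IsUnit (gMat navF x y).det := by
    rw [det_gMat_navF h]
    exact (pow_pos (navRatio_pos h) 4).ne'.isUnit
  have h1 : (gMat navF x y)⁻¹.mulVec ((gMat navF x y).mulVec fun m => navSpray m x y)
      = fun m => navSpray m x y := by
    rw [Matrix.mulVec_mulVec, Matrix.nonsing_inv_mul _ hdet, Matrix.one_mulVec]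
  have h2 := congrFun h1 i
  simp only [Matrix.mulVec, dotProduct] at h2
  rw [spray, ← h2, Finset.mul_sum]
  refine Finset.sum_congr rfl fun l _ => ?_
  rw [gMat_mulVec_navSpray h l]
  ring

end FundamentalTensor

/-! ### Flatness and vanishing divergence of the spray on the ball. -/

section BallCurvature

variable {x y : Coord 3} {L : Coord 3 → Coord 3 → ℝ}

theorem gMat_eq_navF (hL : ∀ x ∈ Metric.ball (0 : Coord 3) 1, ∀ y, L x y = navF x y)
    (hx : x ∈ Metric.ball (0 : Coord 3) 1) (y : Coord 3) : gMat L x y = gMat navF x y := by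
  have : L x = navF x := funext (hL x hx)
  rw [gMat, gMat, this]

/-- The chart expression `L` is controlled only over the ball; the spray, being a local expression,
still agrees there. -/
theorem spray_eq_navSpray (hL : ∀ x ∈ Metric.ball (0 : Coord 3) 1, ∀ y, L x y = navF x y)
    (i : Fin 3) (h : (x, y) ∈ ballSlit) : spray L i x y = navSpray i x y := by
  have h2 : ∀ x y, (x, y) ∈ ballSlit → L x y ^ 2 = navF x y ^ 2 :=
    fun x y h => by rw [hL x h.1]
  have h3 : ∀ l x y, (x, y) ∈ ballSlit →
      dy l (fun x y => L x y ^ 2) x y = dy l (fun x y => navF x y ^ 2) x y :=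
    fun l x y h => dy_congr isOpen_ballSlit h2 l h
  rw [← spray_navF h, spray, spray]
  simp only [gMat_eq_navF hL h.1, dx_congr isOpen_ballSlit h2 _ h,
    fun k l => dx_congr isOpen_ballSlit (h3 l) k h]

theorem contDiffOn_navSpray (i : Fin 3) : ContDiffOn ℝ ∞ (joint (navSpray i)) ballSlit := by
  have h1 : ContDiff ℝ ∞ (joint fun _ y => rot y i) := by
    fin_cases i <;> simp [rot] <;> fun_prop
  have h2 : ContDiff ℝ ∞ (joint fun x _ => rot (rot x) i) := by
    fin_cases i <;> simp [rot] <;> fun_prop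
  exact (contDiffOn_navF.mul h1.contDiffOn).neg.add
    ((contDiffOn_const.mul contDiffOn_navF_sq).mul h2.contDiffOn)

theorem contDiffOn_spray (hL : ∀ x ∈ Metric.ball (0 : Coord 3) 1, ∀ y, L x y = navF x y)
    (i : Fin 3) : ContDiffOn ℝ ∞ (joint (spray L i)) ballSlit :=
  (contDiffOn_navSpray i).congr fun _ hq => spray_eq_navSpray hL i hq

theorem dirDeriv_navSpray (h : (x, y) ∈ ballSlit) (a b : Coord 3) (i : Fin 3) :
    dirDeriv (navSpray i) x y a b
      = -(dirDeriv navF x y a b * rot y i + navF x y * rot b i)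
        + navF x y * dirDeriv navF x y a b * rot (rot x) i
        + (1 / 2) * navF x y ^ 2 * rot (rot a) i := by
  have hd := fun {f} hf => differentiableAt_joint (f := f) isOpen_ballSlit hf h
  have hF := hasDerivAt_dirDeriv (hd contDiffOn_navF) a b
  have hrr : HasDerivAt (fun t : ℝ => rot (rot (x + t • a)) i) (rot (rot a) i) 0 := by
    fin_cases i
    · exact (hasDerivAt_line x a 0).neg
    · exact (hasDerivAt_line x a 1).neg
    · exact hasDerivAt_const _ _
  have h1 := ((hF.fun_mul (hasDerivAt_rot_line y b i)).fun_neg).fun_add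
    (((hF.fun_pow 2).const_mul (1 / 2)).fun_mul hrr)
  rw [(hasDerivAt_dirDeriv (hd (contDiffOn_navSpray i)) a b).unique h1]
  simp
  ring

/-- The two terms containing `∂F/∂yᵏ = p_k` combine, because `rot y - F rot (rot x) = rot V`. -/
theorem dy_navSpray (h : (x, y) ∈ ballSlit) (i k : Fin 3) :
    dy k (navSpray i) x y = -(navP k x y * rot (fun j => navV j x y) i)
      - navF x y * rot (coordVec k : Coord 3) i := by
  have hd := fun {f} hf => differentiableAt_joint (f := f) isOpen_ballSlit hf h
  rw [dy_eq_dirDeriv (hd (contDiffOn_navSpray i)), dirDeriv_navSpray h,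
    ← dy_eq_dirDeriv (hd contDiffOn_navF), dy_navF h]
  fin_cases i <;> simp [rot, navV] <;> ring

theorem dx_navSpray (h : (x, y) ∈ ballSlit) (i k : Fin 3) :
    dx k (navSpray i) x y
      = -(navF x y * rot (fun j => navP j x y) k * rot (fun j => navV j x y) i)
        + (1 / 2) * navF x y ^ 2 * rot (rot (coordVec k : Coord 3)) i := by
  have hd := fun {f} hf => differentiableAt_joint (f := f) isOpen_ballSlit hf h
  rw [dx_eq_dirDeriv (hd (contDiffOn_navSpray i)), dirDeriv_navSpray h,
    ← dx_eq_dirDeriv (hd contDiffOn_navF), dx_navF h]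
  fin_cases i <;> simp [rot, navV] <;> ring

theorem dy_spray (hL : ∀ x ∈ Metric.ball (0 : Coord 3) 1, ∀ y, L x y = navF x y)
    (i k : Fin 3) (h : (x, y) ∈ ballSlit) :
    dy k (spray L i) x y = -(navP k x y * rot (fun j => navV j x y) i)
      - navF x y * rot (coordVec k : Coord 3) i := by
  rw [dy_congr isOpen_ballSlit (fun x y h => spray_eq_navSpray hL i h) k h, dy_navSpray h]

/-- Both contributions vanish because `rot` is skew: `⟨p, rot V⟩ = D ⟨p, rot p⟩ = 0`, and its trace
is zero. -/
theorem sum_dy_spray (hL : ∀ x ∈ Metric.ball (0 : Coord 3) 1, ∀ y, L x y = navF x y)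
    (h : (x, y) ∈ ballSlit) : ∑ m, dy m (spray L m) x y = 0 := by
  simp only [dy_spray hL _ _ h, Fin.sum_univ_three, navV_eq h]
  simp [rot, coordVec]
  ring

theorem sum_mul_dy_spray (hL : ∀ x ∈ Metric.ball (0 : Coord 3) 1, ∀ y, L x y = navF x y)
    (i : Fin 3) (h : (x, y) ∈ ballSlit) :
    ∑ m, y m * dy m (spray L i) x y = 2 * spray L i x y := by
  have hy : y 0 * navP 0 x y + y 1 * navP 1 x y + y 2 * navP 2 x y = navF x y := by
    have h0 := snd_eq h 0
    have h1 := snd_eq h 1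
    have h2 := snd_eq h 2
    have hp := sum_navP_sq h
    have hF := navF_eq_mul h
    simp [rot] at h0 h1 h2
    linear_combination navP 0 x y * h0 + navP 1 x y * h1 + navP 2 x y * h2
      + navRoot x y * hp + (navP 0 x y * x 1 - navP 1 x y * x 0 - 1) * hF
  simp only [dy_spray hL _ _ h, spray_eq_navSpray hL i h, Fin.sum_univ_three, navSpray]
  have hsum : ∑ m, y m * rot (coordVec m : Coord 3) i = rot y i := by
    fin_cases i <;> simp [rot, coordVec]
  rw [Fin.sum_univ_three] at hsum
  have hv : rot (fun j => navV j x y) i = rot y i - navF x y * rot (rot x) i := by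
    fin_cases i <;> simp [rot, navV]
    ring
  linear_combination -navF x y * hsum - rot (fun j => navV j x y) i * hy - navF x y * hv

theorem sprayVec_apply (hL : ∀ x ∈ Metric.ball (0 : Coord 3) 1, ∀ y, L x y = navF x y)
    (h : (x, y) ∈ ballSlit) (i : Fin 3) :
    (-(2 : ℝ) • sprayVec L x y) i = -2 * navSpray i x y := by
  simp [sprayVec, spray_eq_navSpray hL i h]

theorem riemann_eq_zero (hL : ∀ x ∈ Metric.ball (0 : Coord 3) 1, ∀ y, L x y = navF x y)
    (i k : Fin 3) (h : (x, y) ∈ ballSlit) : riemann L i k x y = 0 := by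
  have hd := fun {f} hf => differentiableAt_joint (f := f) isOpen_ballSlit hf h
  have hb := sprayVec_apply hL h
  -- Along the spray, in the formula for `Nⁱ_k`, the factor `F` is constant while `p` and `V`
  -- rotate.
  have hS : geodDeriv L (dy k (spray L i)) x y
      = -(navF x y * rot (fun j => navP j x y) k * rot (fun j => navV j x y) i
        + navP k x y * (navF x y * rot (rot (fun j => navV j x y)) i)) := by
    rw [geodDeriv, dirDeriv_congr isOpen_ballSlit (fun x y h => dy_spray hL i k h) h]
    have hF := hasDerivAt_dirDeriv (hd contDiffOn_navF) y (-(2 : ℝ) • sprayVec L x y)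
    have hP := hasDerivAt_dirDeriv (hd (contDiffOn_navP k)) y (-(2 : ℝ) • sprayVec L x y)
    have hV := fun i =>
      hasDerivAt_dirDeriv (hd (contDiffOn_navV i)) y (-(2 : ℝ) • sprayVec L x y)
    rw [dirDeriv_navF_spray h hb] at hF
    rw [dirDeriv_navP_spray h hb] at hP
    simp only [dirDeriv_navV_spray h hb] at hV
    have hrV : HasDerivAt (fun t : ℝ => rot (fun j => navV j (x + t • y)
        (y + t • (-(2 : ℝ) • sprayVec L x y))) i)
        (navF x y * rot (rot (fun j => navV j x y)) i) 0 := by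
      fin_cases i
      · exact hV 1
      · simpa [rot] using (hV 0).fun_neg
      · simpa [rot] using hasDerivAt_const (0 : ℝ) (0 : ℝ)
    have hs : ContDiffOn ℝ ∞ (joint fun x y => -(navP k x y * rot (fun j => navV j x y) i)
        - navF x y * rot (coordVec k : Coord 3) i) ballSlit :=
      (contDiffOn_dy isOpen_ballSlit (contDiffOn_spray hL i) k).congr fun _ hq =>
        (dy_spray hL i k hq).symm
    rw [(hasDerivAt_dirDeriv (hd hs) _ _).unique
      (((hP.fun_mul hrV).fun_neg).fun_sub (hF.mul_const _))]
    simp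
  rw [riemann_eq isOpen_ballSlit (contDiffOn_spray hL) i k h, hS,
    dx_congr isOpen_ballSlit (fun x y h => spray_eq_navSpray hL i h) k h, dx_navSpray h]
  simp only [dy_spray hL _ _ h, Fin.sum_univ_three, navV_eq h]
  fin_cases i <;> fin_cases k <;> simp [rot, coordVec] <;> ring

end BallCurvature

/-! ### Volume density, distortion and `S`-curvature. -/

section BallVolume

variable {x y : Coord 3} {L : Coord 3 → Coord 3 → ℝ}

theorem navF_lt_one_iff (hx : x ∈ Metric.ball (0 : Coord 3) 1) (y : Coord 3) :
    navF x y < 1 ↔ y ∈ Metric.ball (WithLp.toLp 2 (rot x) : Coord 3) 1 := by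
  have hl := windDefect_pos hx
  rw [windDefect] at hl
  have h1 : navF x y < 1 ↔
      navRoot x y < (1 - x 0 ^ 2 - x 1 ^ 2) + (x 1 * y 0 - x 0 * y 1) := by
    rw [← mul_lt_mul_iff_right₀ hl, windDefect_mul_navF hx]
    constructor <;> intro h <;> linarith
  have h2 : y ∈ Metric.ball (WithLp.toLp 2 (rot x) : Coord 3) 1 ↔
      (y 0 - x 1) ^ 2 + (y 1 + x 0) ^ 2 + y 2 ^ 2 < 1 := by
    rw [mem_ball_iff_norm, ← sq_lt_one_iff₀ (norm_nonneg _), EuclideanSpace.real_norm_sq_eq,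
      Fin.sum_univ_three]
    simp [rot]
  have h3 : 0 ≤ (y 0 ^ 2 + y 1 ^ 2 + y 2 ^ 2) * (1 - x 0 ^ 2 - x 1 ^ 2) := by positivity
  rw [h1, h2, navRoot]
  constructor
  · intro h
    have h4 := (Real.sqrt_nonneg _).trans_lt h
    -- With `λ = 1 - |W|²`, both directions use `(λ + ⟨W, y⟩)² - D² = λ (1 - |y - W|²)`.
    rw [Real.sqrt_lt' h4] at h
    rw [← sub_pos] at h ⊢
    refine pos_of_mul_pos_right (a := 1 - x 0 ^ 2 - x 1 ^ 2) ?_ hl.le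
    linarith
  · intro h
    -- The hypothesis says `λ + 2⟨W, y⟩ > |y|²`; averaging with `λ > 0` makes `λ + ⟨W, y⟩` positive,
    -- as squaring requires.
    have h5 : 0 < (1 - x 0 ^ 2 - x 1 ^ 2) + 2 * (x 1 * y 0 - x 0 * y 1) := by
      nlinarith [sq_nonneg (y 0), sq_nonneg (y 1), sq_nonneg (y 2)]
    rw [Real.sqrt_lt' (by linarith)]
    nlinarith [mul_pos hl (sub_pos.2 h)]

theorem bhDensity_eq_one (hL : ∀ x ∈ Metric.ball (0 : Coord 3) 1, ∀ y, L x y = navF x y)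
    (hx : x ∈ Metric.ball (0 : Coord 3) 1) : bhDensity L x = 1 := by
  have h1 : {y | L x y < 1} = Metric.ball (WithLp.toLp 2 (rot x) : Coord 3) 1 := by
    ext y
    rw [Set.mem_ofPred_eq, hL x hx, navF_lt_one_iff hx]
  rw [bhDensity, h1, MeasureTheory.Measure.addHaar_ball_center _ (WithLp.toLp 2 (rot x))]
  refine div_self (ENNReal.toReal_pos ?_ ?_).ne'
  · exact (Metric.measure_ball_pos _ _ one_pos).ne'
  · exact MeasureTheory.measure_ball_lt_top.ne

/-- With density `1` and `det g = (F/D)⁴`, only `log (F/D)²` remains, a function of two conserved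
quantities. -/
theorem distortion_eq (hL : ∀ x ∈ Metric.ball (0 : Coord 3) 1, ∀ y, L x y = navF x y)
    (h : (x, y) ∈ ballSlit) :
    distortion L x y = 2 * Real.log (navF x y) - 2 * Real.log (navRoot x y) := by
  have h1 : navRatio x y = navF x y / navRoot x y := by
    rw [navF_eq h, mul_div_cancel_left₀ _ (navRoot_pos h).ne']
  rw [distortion, bhDensity_eq_one hL h.1, gMat_eq_navF hL h.1, det_gMat_navF h, div_one,
    show navRatio x y ^ 4 = (navRatio x y ^ 2) ^ 2 by ring, Real.sqrt_sq (by positivity),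
    Real.log_pow, h1, Real.log_div (navF_pos h).ne' (navRoot_pos h).ne']
  push_cast
  ring

theorem differentiableAt_distortion
    (hL : ∀ x ∈ Metric.ball (0 : Coord 3) 1, ∀ y, L x y = navF x y) (h : (x, y) ∈ ballSlit) :
    DifferentiableAt ℝ (joint (distortion L)) (x, y) := by
  have hF := differentiableAt_joint isOpen_ballSlit contDiffOn_navF h
  have hD := differentiableAt_joint isOpen_ballSlit contDiffOn_navRoot h
  refine (((hF.log (navF_pos h).ne').const_mul 2).sub
    ((hD.log (navRoot_pos h).ne').const_mul 2)).congr_of_eventuallyEq ?_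
  exact Filter.eventuallyEq_of_mem (isOpen_ballSlit.mem_nhds h) fun q hq => distortion_eq hL hq

theorem sCurvature_eq_zero (hL : ∀ x ∈ Metric.ball (0 : Coord 3) 1, ∀ y, L x y = navF x y)
    (h : (x, y) ∈ ballSlit) : sCurvature L x y = 0 := by
  have hd := fun {f} hf => differentiableAt_joint (f := f) isOpen_ballSlit hf h
  have hb := sprayVec_apply hL h
  change dirDeriv (distortion L) x y y (-(2 : ℝ) • sprayVec L x y) = 0
  have hF := hasDerivAt_dirDeriv (hd contDiffOn_navF) y (-(2 : ℝ) • sprayVec L x y)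
  have hD := hasDerivAt_dirDeriv (hd contDiffOn_navRoot) y (-(2 : ℝ) • sprayVec L x y)
  rw [dirDeriv_navF_spray h hb] at hF
  rw [dirDeriv_navRoot_spray h hb] at hD
  have hs := ((hF.log (by simpa using (navF_pos h).ne')).const_mul 2).fun_sub
    ((hD.log (by simpa using (navRoot_pos h).ne')).const_mul 2)
  have hdist : DifferentiableAt ℝ (joint fun x y =>
      2 * Real.log (navF x y) - 2 * Real.log (navRoot x y)) (x, y) :=
    (((hd contDiffOn_navF).log (navF_pos h).ne').const_mul 2).sub
      (((hd contDiffOn_navRoot).log (navRoot_pos h).ne').const_mul 2)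
  rw [dirDeriv_congr isOpen_ballSlit (fun x y h => distortion_eq hL h) h,
    (hasDerivAt_dirDeriv hdist _ _).unique hs]
  simp

end BallVolume

/-! ### A nonzero component of the Berwald curvature at the centre. -/

section BallBerwald

variable {L : Coord 3 → Coord 3 → ℝ}

/-- The line `(1, t, 0)`. -/
def testLine (t : ℝ) : Coord 3 := WithLp.toLp 2 ![1, t, 0]

theorem testLine_ne_zero (t : ℝ) : testLine t ≠ 0 := fun h => by
  simpa [testLine] using congrArg (fun y : Coord 3 => y 0) h

theorem dy_testLine {f : Coord 3 → Coord 3 → ℝ} {x : Coord 3} {φ φ' : ℝ → ℝ}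
    (h : ∀ t, f x (testLine t) = φ t) (hφ : ∀ t, HasDerivAt φ (φ' t) t) (t : ℝ) :
    dy 1 f x (testLine t) = φ' t := by
  have h1 : ∀ s : ℝ, testLine t + s • (coordVec 1 : Coord 3) = testLine (t + s) := fun s => by
    ext i
    fin_cases i <;> simp [testLine, coordVec]
  rw [dy, lineDeriv]
  simp only [h1, h]
  have := (hφ (t + 0)).comp_const_add t 0
  rw [this.deriv, add_zero]

theorem spray_testLine (hL : ∀ x ∈ Metric.ball (0 : Coord 3) 1, ∀ y, L x y = navF x y) (t : ℝ) :
    spray L 0 0 (testLine t) = -(t * Real.sqrt (1 + t ^ 2)) := by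
  have h : ((0 : Coord 3), testLine t) ∈ ballSlit := ⟨by simp, testLine_ne_zero t⟩
  rw [spray_eq_navSpray hL 0 h]
  simp [navSpray, navF, navRoot, testLine, rot, mul_comm]

/-- At the centre the wind vanishes and `F = |y|`. The value is the third derivative at `0` of `-t
√(1 + t²) = -t - t³/2 + ⋯`. -/
theorem berwald_testLine (hL : ∀ x ∈ Metric.ball (0 : Coord 3) 1, ∀ y, L x y = navF x y) :
    berwald L 0 1 1 1 0 (testLine 0) = -3 := by
  have hpos : ∀ t : ℝ, 0 < 1 + t ^ 2 := fun t => by positivity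
  have hr : ∀ t : ℝ, HasDerivAt (fun t : ℝ => Real.sqrt (1 + t ^ 2)) (t / Real.sqrt (1 + t ^ 2)) t :=
    fun t => by
      refine (((hasDerivAt_pow 2 t).const_add 1).sqrt (hpos t).ne').congr_deriv ?_
      simp
      field_simp
  have h1 : ∀ t : ℝ, HasDerivAt (fun t : ℝ => -(t * Real.sqrt (1 + t ^ 2)))
      (-(1 + 2 * t ^ 2) / Real.sqrt (1 + t ^ 2)) t := fun t => by
    have h2 := Real.sq_sqrt (hpos t).le
    have h3 := (Real.sqrt_pos.2 (hpos t)).ne'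
    refine ((hasDerivAt_id' t).fun_mul (hr t)).fun_neg.congr_deriv ?_
    simp
    field_simp
    rw [h2]
    ring
  have h2 : ∀ t : ℝ, HasDerivAt (fun t : ℝ => -(1 + 2 * t ^ 2) / Real.sqrt (1 + t ^ 2))
      (-(3 * t + 2 * t ^ 3) / Real.sqrt (1 + t ^ 2) ^ 3) t := fun t => by
    have h2 := Real.sq_sqrt (hpos t).le
    have h3 := (Real.sqrt_pos.2 (hpos t)).ne'
    refine (((((hasDerivAt_pow 2 t).const_mul 2).const_add 1).fun_neg).fun_div (hr t)
      h3).congr_deriv ?_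
    field_simp
    rw [h2]
    ring
  -- The last derivative stays unsimplified, since only its value at `t = 0` is needed.
  have h3 : ∀ t : ℝ, HasDerivAt (fun t : ℝ => -(3 * t + 2 * t ^ 3) / Real.sqrt (1 + t ^ 2) ^ 3)
      (((-(3 + 6 * t ^ 2)) * Real.sqrt (1 + t ^ 2) ^ 3 - (-(3 * t + 2 * t ^ 3)) *
        (3 * Real.sqrt (1 + t ^ 2) ^ 2 * (t / Real.sqrt (1 + t ^ 2)))) /
        (Real.sqrt (1 + t ^ 2) ^ 3) ^ 2) t := fun t => by
    have h3 := (Real.sqrt_pos.2 (hpos t)).ne'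
    refine (((((hasDerivAt_id' t).const_mul 3).fun_add
      ((hasDerivAt_pow 3 t).const_mul 2)).fun_neg).fun_div ((hr t).fun_pow 3)
      (pow_ne_zero 3 h3)).congr_deriv ?_
    push_cast
    ring
  rw [berwald, dy_testLine (dy_testLine (dy_testLine (spray_testLine hL) h1) h2) h3]
  simp

end BallBerwald

/-! ### Charts and tangent bundle of the ball in Cartesian coordinates. -/

section BallManifold

theorem coe_chartAt_symm {p : unitBall} {x : Coord 3} (hx : x ∈ (chartAt (Coord 3) p).target) :
    ((chartAt (Coord 3) p).symm x : Coord 3) = x :=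
  (chartAt (Coord 3) p).right_inv hx

theorem target_chartAt (p : unitBall) : (chartAt (Coord 3) p).target = Metric.ball 0 1 := by
  ext x
  constructor
  · intro hx
    rw [← coe_chartAt_symm hx]
    exact ((chartAt (Coord 3) p).symm x).2
  · intro hx
    have h : (⟨x, hx⟩ : unitBall) ∈ (chartAt (Coord 3) p).source := by
      simp [TopologicalSpace.Opens.chartAt_eq, chartAt_self_eq]
    exact (chartAt (Coord 3) p).map_source h

theorem mem_atlas_unitBall {e : OpenPartialHomeomorph unitBall (Coord 3)}
    (he : e ∈ atlas (Coord 3) unitBall) : ∃ p : unitBall, e = chartAt (Coord 3) p := by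
  obtain ⟨p, hp⟩ := Set.mem_iUnion.1 he
  exact ⟨p, hp⟩

/-- The tangent space at `p` is the model space, and the inclusion read in the chart at `p` is the
identity. -/
theorem mfderiv_subtypeVal (p : unitBall) (y : TangentSpace (𝓡 3) p) :
    mfderiv (𝓡 3) (𝓡 3) (Subtype.val : unitBall → Coord 3) p y = (y : Coord 3) := by
  have hd : MDifferentiableAt (𝓡 3) (𝓡 3) (Subtype.val : unitBall → Coord 3) p :=
    contMDiff_subtype_val.contMDiffAt.mdifferentiableAt (n := 1) (by simp)
  have h1 : writtenInExtChartAt (𝓡 3) (𝓡 3) p (Subtype.val : unitBall → Coord 3)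
      =ᶠ[nhds (extChartAt (𝓡 3) p p)] id := by
    have ht : (chartAt (Coord 3) p).target ∈ nhds (extChartAt (𝓡 3) p p) :=
      (chartAt (Coord 3) p).open_target.mem_nhds
        ((chartAt (Coord 3) p).map_source (mem_chart_source _ p))
    filter_upwards [ht] with x hx
    exact coe_chartAt_symm hx
  rw [hd.mfderiv]
  have h2 : fderivWithin ℝ (writtenInExtChartAt (𝓡 3) (𝓡 3) p (Subtype.val : unitBall → Coord 3))
      (Set.range (𝓡 3)) (extChartAt (𝓡 3) p p) = ContinuousLinearMap.id ℝ _ := by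
    rw [ModelWithCorners.range_eq_univ, fderivWithin_univ, h1.fderiv_eq, fderiv_id]
  exact congrArg (fun T : Coord 3 →L[ℝ] Coord 3 => T y) h2

theorem mfderiv_chartAt_symm (p : unitBall) {x : Coord 3}
    (hx : x ∈ Metric.ball (0 : Coord 3) 1) (y : Coord 3) :
    mfderiv (𝓡 3) (𝓡 3) (chartAt (Coord 3) p).symm x y = y := by
  rw [← target_chartAt p] at hx
  have hs : MDifferentiableAt (𝓡 3) (𝓡 3) (chartAt (Coord 3) p).symm x :=
    mdifferentiableAt_atlas_symm (chart_mem_atlas _ p) hx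
  have hd : MDifferentiableAt (𝓡 3) (𝓡 3) (Subtype.val : unitBall → Coord 3)
      ((chartAt (Coord 3) p).symm x) :=
    contMDiff_subtype_val.contMDiffAt.mdifferentiableAt (n := 1) (by simp)
  have h1 := mfderiv_comp x hd hs
  have h2 : (Subtype.val : unitBall → Coord 3) ∘ (chartAt (Coord 3) p).symm =ᶠ[nhds x] id := by
    filter_upwards [(chartAt (Coord 3) p).open_target.mem_nhds hx] with x hx
    exact coe_chartAt_symm hx
  rw [h2.mfderiv_eq, mfderiv_id] at h1
  have h3 := congrArg (fun T : Coord 3 →L[ℝ] Coord 3 => T y) h1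
  exact ((mfderiv_subtypeVal _ _).symm.trans h3.symm)

theorem localRep_chartAt (f : TangentBundle (𝓡 3) unitBall → ℝ) (g : Coord 3 → Coord 3 → ℝ)
    (hfg : ∀ q : TangentBundle (𝓡 3) unitBall, f q = g q.1 q.2) (p : unitBall) {x : Coord 3}
    (hx : x ∈ Metric.ball (0 : Coord 3) 1) (y : Coord 3) :
    localRep f (chartAt (Coord 3) p) x y = g x y := by
  rw [localRep, hfg, mfderiv_chartAt_symm p hx y]
  rw [← target_chartAt p] at hx
  exact congrArg (fun x => g x y) (coe_chartAt_symm hx)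

theorem localRep_ballRanders (p : unitBall) {x : Coord 3}
    (hx : x ∈ Metric.ball (0 : Coord 3) 1) (y : Coord 3) :
    localRep ballRanders (chartAt (Coord 3) p) x y = navF x y :=
  localRep_chartAt ballRanders navF (fun _ => rfl) p hx y

theorem everywhereOnSlit_unitBall {P : OpenPartialHomeomorph unitBall (Coord 3) → Coord 3 →
      Coord 3 → Prop}
    (h : ∀ p : unitBall, ∀ x y, (x, y) ∈ ballSlit → P (chartAt (Coord 3) p) x y) :
    EverywhereOnSlit unitBall P := by
  intro e he x hx y hy
  obtain ⟨p, rfl⟩ := mem_atlas_unitBall he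
  rw [target_chartAt] at hx
  exact h p x y ⟨hx, hy⟩

/-- Position and components of a tangent vector of the ball. -/
def ballCoords (q : TangentBundle (𝓡 3) unitBall) : Coord 3 × Coord 3 := (q.1, q.2)

/-- The fibre component is that of the tangent map of the inclusion, which lands in the trivial
bundle `Tℝ³`. -/
theorem contMDiff_ballCoords :
    ContMDiff (𝓡 3).tangent 𝓘(ℝ, Coord 3 × Coord 3) ∞ ballCoords := by
  have h1 : ContMDiff (𝓡 3).tangent (𝓡 3) ∞
      fun q : TangentBundle (𝓡 3) unitBall => (q.1 : Coord 3) :=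
    contMDiff_subtype_val.comp (Bundle.contMDiff_proj (TangentSpace (𝓡 3)))
  have h2 : ContMDiff (𝓡 3).tangent (𝓡 3).tangent ∞
      (tangentMap (𝓡 3) (𝓡 3) (Subtype.val : unitBall → Coord 3)) :=
    (contMDiff_subtype_val (n := ∞)).contMDiff_tangentMap (by simp)
  have h3 := (contMDiff_snd_tangentBundle_modelSpace (n := ∞) (Coord 3) (𝓡 3)).comp h2
  have h4 : ContMDiff (𝓡 3).tangent 𝓘(ℝ, Coord 3) ∞
      fun q : TangentBundle (𝓡 3) unitBall => (q.2 : Coord 3) :=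
    h3.congr fun q => (mfderiv_subtypeVal q.1 q.2).symm
  exact h1.prodMk_space h4

theorem contMDiffOn_of_contDiffOn {f : TangentBundle (𝓡 3) unitBall → ℝ}
    {g : Coord 3 → Coord 3 → ℝ} (hfg : ∀ q : TangentBundle (𝓡 3) unitBall, f q = g q.1 q.2)
    (hg : ContDiffOn ℝ ∞ (joint g) ballSlit) :
    ContMDiffOn (𝓡 3).tangent 𝓘(ℝ, ℝ) ∞ f {v | v.2 ≠ 0} :=
  (hg.contMDiffOn.comp contMDiff_ballCoords.contMDiffOn fun q hq => ⟨q.1.2, hq⟩).congr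
    fun q _ => hfg q

theorem contMDiff_of_contDiffOn {f : TangentBundle (𝓡 3) unitBall → ℝ}
    {g : Coord 3 → Coord 3 → ℝ} (hfg : ∀ q : TangentBundle (𝓡 3) unitBall, f q = g q.1 q.2)
    (hg : ContDiffOn ℝ ∞ (joint g) (Metric.ball 0 1 ×ˢ Set.univ)) :
    ContMDiff (𝓡 3).tangent 𝓘(ℝ, ℝ) ∞ f := by
  rw [← contMDiffOn_univ]
  exact (hg.contMDiffOn.comp contMDiff_ballCoords.contMDiffOn
    fun q _ => ⟨q.1.2, Set.mem_univ _⟩).congr fun q _ => hfg q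

end BallManifold

/-! ### The Finsler and Randers structures, and the stated properties of the example. -/

section BallMetric

theorem navF_zero (x : Coord 3) : navF x 0 = 0 := by
  simp [navF, navRoot]

theorem navF_smul (x y : Coord 3) {c : ℝ} (hc : 0 < c) : navF x (c • y) = c * navF x y := by
  have h : navRoot x (c • y) = c * navRoot x y := by
    rw [navRoot, navRoot, ← Real.sqrt_sq hc.le, ← Real.sqrt_mul (sq_nonneg c), Real.sqrt_sq hc.le]
    congr 1
    simp
    ring
  rw [navF, navF, h]
  simp
  ring

theorem navF_nonneg {x : Coord 3} (hx : x ∈ Metric.ball (0 : Coord 3) 1) (y : Coord 3) :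
    0 ≤ navF x y := by
  by_cases hy : y = 0
  · rw [hy, navF_zero]
  · have h : (x, y) ∈ ballSlit := ⟨hx, hy⟩
    exact (navF_pos h).le

theorem isFinslerMetric_ballRanders : IsFinslerMetric ballRanders where
  nonneg := fun q => navF_nonneg q.1.2 q.2
  smooth := contMDiffOn_of_contDiffOn (fun _ => rfl) contDiffOn_navF
  homogeneous := fun p y _ hc => navF_smul p.1 y hc
  posDef := fun p y u hy hu => by
    have h : ((p : Coord 3), (y : Coord 3)) ∈ ballSlit := ⟨p.2, hy⟩
    exact fundForm_navF_pos h hu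

/-- The Riemannian metric `a` with `α(y) = √(a(y, y))`. -/
def ballForm (x : Coord 3) : Coord 3 →ₗ[ℝ] Coord 3 →ₗ[ℝ] ℝ :=
  LinearMap.mk₂ ℝ (fun u w =>
    ((-(x 1) * u 0 + x 0 * u 1) * (-(x 1) * w 0 + x 0 * w 1)
      + (u 0 * w 0 + u 1 * w 1 + u 2 * w 2) * (1 - x 0 ^ 2 - x 1 ^ 2))
      / (1 - x 0 ^ 2 - x 1 ^ 2) ^ 2)
    (fun _ _ _ => by simp; ring) (fun _ _ _ => by simp; ring)
    (fun _ _ _ => by simp; ring) (fun _ _ _ => by simp; ring)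

theorem ballForm_comm (x u w : Coord 3) : ballForm x u w = ballForm x w u := by
  simp only [ballForm, LinearMap.mk₂_apply]
  ring

theorem ballForm_self (x y : Coord 3) : ballForm x y y =
    ((-(x 1) * y 0 + x 0 * y 1) ^ 2
      + (y 0 ^ 2 + y 1 ^ 2 + y 2 ^ 2) * (1 - x 0 ^ 2 - x 1 ^ 2)) / (1 - x 0 ^ 2 - x 1 ^ 2) ^ 2 := by
  simp only [ballForm, LinearMap.mk₂_apply]
  ring

theorem ballAlpha_eq_sqrt (p : unitBall) (y : Coord 3) :
    ballAlpha ⟨p, y⟩ = Real.sqrt (ballForm p y y) := by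
  have hl : 0 < windDefect (p : Coord 3) := windDefect_pos p.2
  rw [windDefect] at hl
  rw [ballForm_self, Real.sqrt_div' _ (sq_nonneg _), Real.sqrt_sq hl.le]
  rfl

theorem ballForm_self_pos {x y : Coord 3} (hx : x ∈ Metric.ball (0 : Coord 3) 1) (hy : y ≠ 0) :
    0 < ballForm x y y := by
  have hl := windDefect_pos hx
  rw [windDefect] at hl
  have h : (x, y) ∈ ballSlit := ⟨hx, hy⟩
  rw [ballForm_self]
  exact div_pos (navRadicand_pos h) (by positivity)

theorem ballForm_self_nonneg {x : Coord 3} (hx : x ∈ Metric.ball (0 : Coord 3) 1) (y : Coord 3) :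
    0 ≤ ballForm x y y := by
  by_cases hy : y = 0
  · simp [hy]
  · exact (ballForm_self_pos hx hy).le

theorem windDefect_ne_zero_of_mem :
    ∀ q ∈ Metric.ball (0 : Coord 3) 1 ×ˢ (Set.univ : Set (Coord 3)),
      (1 - q.1 0 ^ 2 - q.1 1 ^ 2) ≠ 0 := fun _ hq => (windDefect_pos hq.1).ne'

theorem isRiemannianNorm_ballAlpha : IsRiemannianNorm ballAlpha where
  smooth_sq := by
    refine contMDiff_of_contDiffOn (g := fun x y => ((-(x 1) * y 0 + x 0 * y 1) ^ 2
      + (y 0 ^ 2 + y 1 ^ 2 + y 2 ^ 2) * (1 - x 0 ^ 2 - x 1 ^ 2)) / (1 - x 0 ^ 2 - x 1 ^ 2) ^ 2)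
      (fun q => ?_) ?_
    · exact ((congrArg (· ^ 2) (ballAlpha_eq_sqrt q.1 q.2)).trans
        (Real.sq_sqrt (ballForm_self_nonneg q.1.2 q.2))).trans (ballForm_self _ _)
    · exact ContDiffOn.div (by fun_prop) (by fun_prop)
        fun q hq => pow_ne_zero 2 (windDefect_ne_zero_of_mem q hq)
  exists_form := fun p =>
    ⟨ballForm p, ballForm_comm p, fun _ hu => ballForm_self_pos p.2 hu, ballAlpha_eq_sqrt p⟩

/-- The 1-form `β` in Cartesian coordinates. -/
def navBeta (x y : Coord 3) : ℝ := (-(x 1) * y 0 + x 0 * y 1) / (1 - x 0 ^ 2 - x 1 ^ 2)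

theorem isLinearMap_navBeta (x : Coord 3) : IsLinearMap ℝ (navBeta x) := by
  refine ⟨fun u w => ?_, fun c u => ?_⟩ <;> simp [navBeta] <;> ring

theorem isOneForm_ballBeta : IsOneForm ballBeta where
  smooth := contMDiff_of_contDiffOn
    (g := navBeta) (fun _ => rfl)
    (ContDiffOn.div (by fun_prop) (by fun_prop) windDefect_ne_zero_of_mem)
  linear := fun p => isLinearMap_navBeta p

theorem isRandersMetric_ballRanders : IsRandersMetric ballRanders ballAlpha ballBeta where
  eq_add := fun _ => rfl
  riemannian := isRiemannianNorm_ballAlpha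
  oneForm := isOneForm_ballBeta
  norm_lt_one := fun q hq => by
    obtain ⟨⟨x, hx⟩, y⟩ := q
    change Coord 3 at y
    have hl := windDefect_pos hx
    rw [windDefect] at hl
    change |(-(x 1) * y 0 + x 0 * y 1) / (1 - x 0 ^ 2 - x 1 ^ 2)|
      < navRoot x y / (1 - x 0 ^ 2 - x 1 ^ 2)
    rw [abs_div, abs_of_pos hl]
    refine div_lt_div_of_pos_right (Real.lt_sqrt_of_sq_lt ?_) hl
    have := mul_pos (sq_sum_pos hq) hl
    rw [sq_abs]
    linarith

/-- The centre of the ball. -/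
def ballCenter : unitBall := ⟨0, Metric.mem_ball_self one_pos⟩

theorem not_isClosedOneForm_ballBeta : ¬ IsClosedOneForm ballBeta := by
  intro h
  have h0 : (0 : Coord 3) ∈ (chartAt (Coord 3) ballCenter).target := by
    rw [target_chartAt]
    exact Metric.mem_ball_self one_pos
  have h1 := h _ (chart_mem_atlas _ ballCenter) 0 h0 0 1
  have hrep : ∀ y, (fun x => localRep ballBeta (chartAt (Coord 3) ballCenter) x y)
      =ᶠ[nhds 0] fun x => (-(x 1) * y 0 + x 0 * y 1) / (1 - x 0 ^ 2 - x 1 ^ 2) := fun y => by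
    filter_upwards [Metric.isOpen_ball.mem_nhds (Metric.mem_ball_self one_pos)] with x hx
    exact localRep_chartAt ballBeta navBeta (fun _ => rfl) ballCenter hx y
  rw [(hrep _).lineDeriv_eq, (hrep _).lineDeriv_eq, lineDeriv, lineDeriv] at h1
  -- On the first two axes, `b_1(t e₀) = t/(1 - t²)` and `b_0(t e₁) = -t/(1 - t²)`, so closedness at
  -- the centre would force `1 = -1`.
  have hd : HasDerivAt (fun t : ℝ => t / (1 - t ^ 2)) 1 0 := by
    refine ((hasDerivAt_id' (0 : ℝ)).fun_div ((hasDerivAt_pow 2 (0 : ℝ)).const_sub 1)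
      (by norm_num)).congr_deriv ?_
    norm_num
  have hd' : HasDerivAt (fun t : ℝ => -t / (1 - t ^ 2)) (-1) 0 := by
    refine hd.fun_neg.congr_of_eventuallyEq (Filter.Eventually.of_forall fun t => ?_)
    exact neg_div _ _
  simp [coordVec, hd.deriv, hd'.deriv] at h1
  norm_num at h1

theorem flagCurvatureVanishes_ballRanders : FlagCurvatureVanishes ballRanders :=
  everywhereOnSlit_unitBall fun p _ _ h u _ =>
    flagCurvature_eq_zero (fun i k => riemann_eq_zero (fun _ => localRep_ballRanders p) i k h) u

theorem sCurvatureVanishes_ballRanders : SCurvatureVanishes ballRanders :=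
  everywhereOnSlit_unitBall fun p _ _ h =>
    ⟨differentiableAt_distortion (fun _ => localRep_ballRanders p) h,
      sCurvature_eq_zero (fun _ => localRep_ballRanders p) h⟩

theorem thetaVanishes_ballRanders : ThetaVanishes ballRanders :=
  everywhereOnSlit_unitBall fun p _ _ h j k l =>
    have hL := fun x => localRep_ballRanders p (x := x)
    theta_eq_zero isOpen_ballSlit (contDiffOn_spray hL) (fun _ _ h => sum_dy_spray hL h)
      (fun i k _ _ h => riemann_eq_zero hL i k h) j k l h

theorem dTildeVanishes_ballRanders : DTildeVanishes ballRanders :=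
  everywhereOnSlit_unitBall fun p _ _ h i j k l =>
    have hL := fun x => localRep_ballRanders p (x := x)
    dTilde_eq_zero isOpen_ballSlit (contDiffOn_spray hL) (fun i _ _ h => sum_mul_dy_spray hL i h)
      (fun _ _ h => sum_dy_spray hL h) (fun i k _ _ h => riemann_eq_zero hL i k h) i j k l h

theorem not_douglasVanishes_ballRanders : ¬ DouglasVanishes ballRanders := by
  intro hD
  have hL := fun x => localRep_ballRanders ballCenter (x := x)
  have h : ((0 : Coord 3), testLine 0) ∈ ballSlit := ⟨by simp, testLine_ne_zero 0⟩
  have h0 : (0 : Coord 3) ∈ (chartAt (Coord 3) ballCenter).target := by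
    rw [target_chartAt]
    exact h.1
  have h1 := hD _ (chart_mem_atlas _ ballCenter) 0 h0 _ (testLine_ne_zero 0) 0 1 1 1
  rw [douglas_eq_berwald isOpen_ballSlit (fun _ _ h => sum_dy_spray hL h) _ _ _ _ h,
    berwald_testLine hL] at h1
  norm_num at h1

end BallMetric

end

end FinslerGeom

theorem mainTheorem7 :
    (∀ (n : ℕ) (M : Type*) [TopologicalSpace M] [ChartedSpace (FinslerGeom.Coord n) M]
        [IsManifold (𝓡 n) ∞ M] (F : TangentBundle (𝓡 n) M → ℝ),
        FinslerGeom.IsDouglasMetric F → FinslerGeom.IsGeneralizedDTildeMetric F) ∧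
    FinslerGeom.IsFinslerMetric FinslerGeom.ballRanders ∧
    FinslerGeom.IsRandersMetric
      FinslerGeom.ballRanders FinslerGeom.ballAlpha FinslerGeom.ballBeta ∧
    FinslerGeom.FlagCurvatureVanishes FinslerGeom.ballRanders ∧
    FinslerGeom.SCurvatureVanishes FinslerGeom.ballRanders ∧
    ¬ FinslerGeom.IsClosedOneForm FinslerGeom.ballBeta ∧
    FinslerGeom.ThetaVanishes FinslerGeom.ballRanders ∧
    FinslerGeom.DTildeVanishes FinslerGeom.ballRanders ∧
    ¬ FinslerGeom.DouglasVanishes FinslerGeom.ballRanders ∧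
    FinslerGeom.IsGeneralizedDTildeMetric FinslerGeom.ballRanders ∧
    ¬ FinslerGeom.IsDouglasMetric FinslerGeom.ballRanders :=
  ⟨fun _ _ _ _ _ _ hF => hF.isGeneralizedDTildeMetric,
    FinslerGeom.isFinslerMetric_ballRanders,
    FinslerGeom.isRandersMetric_ballRanders,
    FinslerGeom.flagCurvatureVanishes_ballRanders,
    FinslerGeom.sCurvatureVanishes_ballRanders,
    FinslerGeom.not_isClosedOneForm_ballBeta,
    FinslerGeom.thetaVanishes_ballRanders,
    FinslerGeom.dTildeVanishes_ballRanders,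
    FinslerGeom.not_douglasVanishes_ballRanders,
    FinslerGeom.isFinslerMetric_ballRanders.isGeneralizedDTildeMetric
      FinslerGeom.dTildeVanishes_ballRanders,
    fun h => FinslerGeom.not_douglasVanishes_ballRanders h.2⟩
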